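/- **Setting.** Let $(\Theta,\mathcal T)$ and $(\Omega,\mathcal F)$ be measurable spaces and $(\mathbb P_\theta)_{\theta\in\Theta}$ a transition (probability) kernel from $\Theta$ to $\Omega$, with expectation $\mathbb E_\theta$, variance $\mathrm{Var}_\theta$ and law $\mathcal L_\theta$. All random variables below are jointly measurable functions $X=X(\theta,\omega)=X_\theta(\omega)$ on $\Theta\times\Omega$, real valued unless stated otherwise. Let $Y$ be a random variable with $\mathbb E_\theta Y^2<\infty$ for all $\theta$; put $\mu_\theta=\mathbb E_\theta Y$, $\sigma_\theta^2=\mathrm{Var}_\theta Y$, and $W=(Y-\mu_\theta)/\sigma_\theta$ if $\sigma_\theta>0$, $W=0$ otherwise. Majorants ($\overline G,\overline D,\overline B$ below) are thought of as nonnegative; in general, expectations involving them are read as expectations of the positive part of the variable in braces. $I_F$ is the indicator of $F$. Relations between random variables "on" an event are meant $\mathbb P_\theta$-almost surely. **Conditions.** (G1) $r:\Theta\to(0,\infty)$ is measurable, $\overline r>0$, $\Theta_0=\{\theta\in\Theta: r_\theta>\overline r\}$, and $\sigma^2_\theta>0$ for all $\theta\in\Theta_0$. (G2) $W'$ and $G$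 are random variables such that for each $\theta\in\Theta_0$ the triple $(W,W',G)$ is a Stein coupling under $\mathbb P_\theta$: $\mathbb E_\theta\{Gf(W')-Gf(W)\}=\mathbb E_\theta\{Wf(W)\}$ for all measurable $f:\mathbb R\to\mathbb R$ for which both expectations exist (that is, both variables in braces are integrable). (G3) With $D=W'-W$, $GD$ is $\mathbb P_\theta$-integrable for each $\theta\in\Theta_0$, and $$\sup_{\theta\in\Theta_0} r_\theta\,\mathbb E_\theta\bigl|\mathbb E_\theta(1-GD\mid W)\bigr|<\infty,\qquad \sup_{\theta\in\Theta_0} r_\theta\,\mathbb E_\theta\{(1+|W|)|G|D^2\}<\infty.$$ (G4) For each $\theta\in\Theta_0$, $\mathcal F_\theta\subset\mathcal F$ is a sub-$\sigma$-algebra; $\overline G,\overline D$ are random variables with $\overline G_\theta,\overline D_\theta$ $\mathcal F_\theta$-measurable for $\theta\in\Theta_0$; and there are events $F_{\theta,1}\in\mathcal F$ (not necessarily in $\mathcal F_\theta$) on which $|G|\le\overline G$ and $|D|\le\overline D$, with $$\sup_{\theta\in\Theta_0} r_\theta^2\,\mathbb E_\theta\{|G|D^2(1-I_{F_{\theta,1}})\}<\infty,\qquad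 \sup_{\theta\in\Theta_0} r_\theta\,\mathbb E_\theta\{\overline G\,\overline D^2\}<\infty.$$ (G5) $\Psi$ is a $\Theta$-valued random element (jointly measurable in $(\theta,\omega)$) with $\Psi_\theta$ $\mathcal F_\theta$-measurable for each $\theta\in\Theta_0$; $V$ is a random variable; and for each $\theta\in\Theta_0$ there is $F_{\theta,2}\in\mathcal F_\theta$ with $\mathcal L_\theta(V\mid\mathcal F_\theta)=\mathcal L_{\Psi_\theta}(Y)$ on $F_{\theta,2}$, that is, for every Borel set $A$, $\mathbb P_\theta[V\in A\mid\mathcal F_\theta](\omega)=\mathbb P_{\Psi_\theta(\omega)}[Y\in A]$ for $\mathbb P_\theta$-almost all $\omega\in F_{\theta,2}$; and $$\sup_{\theta\in\Theta_0} r_\theta^2\,\mathbb E_\theta\{|G|D^2(1-I_{F_{\theta,2}})\}<\infty.$$ (G6) $\overline B$ is a random variable with $\overline B_\theta$ $\mathcal F_\theta$-measurable for each $\theta\in\Theta_0$, with $\sigma_\theta^{-1}|Y-V|\le\overline B$ on $F_{\theta,1}$ for each $\theta\in\Theta_0$, and $$\sup_{\theta\in\Theta_0} r_\theta^2\,\mathbb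 E_\theta\{\overline G\,\overline D^2\,\overline B\,I_{F_{\theta,2}}\}<\infty.$$ (G7) With essential suprema taken with respect to $\mathbb P_\theta$, $$\sup_{\theta\in\Theta_0}\operatorname*{ess\,sup}_{\omega\in F_{\theta,2}\cap\{\Psi_\theta\in\Theta_0\}}\frac{\sigma_\theta^2}{\sigma^2_{\Psi_\theta(\omega)}}<\infty,\quad \sup_{\theta\in\Theta_0}\operatorname*{ess\,sup}_{\omega\in F_{\theta,2}}\frac{r_\theta}{r_{\Psi_\theta(\omega)}}<\infty,\quad \sup_{\theta\in\Theta_0}\operatorname*{ess\,sup}_{\omega\in F_{\theta,2}\cap\{\Psi_\theta\in\Theta_0\}}\frac{r_{\Psi_\theta(\omega)}}{r_\theta}<\infty.$$ **Theorem.** If (G1)–(G7) hold, then there is a constant $C$, independent of $\theta$, such that, with $Z$ a standard normal random variable, $$\sup_{z\in\mathbb R}\bigl|\mathbb P_\theta[W\le z]-\mathbb P[Z\le z]\bigr|\le\frac{C}{r_\theta}\qquad\text{for all }\theta\in\Theta.$$ -/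

import Mathlib

open MeasureTheory ProbabilityTheory
open scoped ENNReal

noncomputable section

/-- The set of well-behaved parameters, `{θ | r θ > rbar}`. -/
def goodSet {Θ : Type*} (r : Θ → ℝ) (rbar : ℝ) : Set Θ := {θ | rbar < r θ}

/-- `W θ = (Y θ - μ_θ) / σ_θ` if `σ_θ > 0`, and `W θ = 0` otherwise, where `μ_θ` and `σ_θ²` are the
mean and the variance of `Y θ` under `P θ`. -/
def standardize {Θ Ω : Type*} [MeasurableSpace Θ] [MeasurableSpace Ω]
    (P : Kernel Θ Ω) (Y : Θ → Ω → ℝ) (θ : Θ) (ω : Ω) : ℝ :=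
  open Classical in
  if 0 < Var[Y θ; P θ] then (Y θ ω - ∫ ω', Y θ ω' ∂(P θ)) / √Var[Y θ; P θ] else 0

/-- The difference `D = W' - W`, where `W` is the standardized version of `Y`. -/
def couplingDiff {Θ Ω : Type*} [MeasurableSpace Θ] [MeasurableSpace Ω]
    (P : Kernel Θ Ω) (Y W' : Θ → Ω → ℝ) (θ : Θ) (ω : Ω) : ℝ :=
  W' θ ω - standardize P Y θ ω

/-- `(W, W', G)` is a Stein coupling under `μ`: `E {G f(W') - G f(W)} = E {W f(W)}` for all
(measurable) `f` for which these two expectations exist. -/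
def IsSteinCoupling {Ω : Type*} [MeasurableSpace Ω] (μ : Measure Ω) (W W' G : Ω → ℝ) : Prop :=
  ∀ f : ℝ → ℝ, Measurable f →
    Integrable (fun ω => G ω * f (W' ω) - G ω * f (W ω)) μ →
    Integrable (fun ω => W ω * f (W ω)) μ →
    ∫ ω, (G ω * f (W' ω) - G ω * f (W ω)) ∂μ = ∫ ω, W ω * f (W ω) ∂μ

/-- The expectation of a nonnegative random variable, as an element of `[0, ∞]`.
(If `X` takes negative values, this is the expectation of its positive part.) -/
def posExp {Ω : Type*} [MeasurableSpace Ω] (μ : Measure Ω) (X : Ω → ℝ) : ℝ≥0∞ :=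
  ∫⁻ ω, ENNReal.ofReal (X ω) ∂μ

/-- `ess sup_{ω ∈ S} X ω` with respect to `μ`, for a nonnegative `X`, as an element of `[0, ∞]`
(it is `0` if `S` is a null set). -/
def essSupOn {Ω : Type*} [MeasurableSpace Ω] (μ : Measure Ω) (S : Set Ω) (X : Ω → ℝ) : ℝ≥0∞ :=
  essSup (fun ω => ENNReal.ofReal (X ω)) (μ.restrict S)

/-- The conditional law of `V` given the sub-σ-algebra `m` is, at almost every point `ω` of the
event `F`, the probability measure `ν ω`. -/
def HasCondLawOn {Ω : Type*} [m0 : MeasurableSpace Ω] (μ : Measure Ω) (m : MeasurableSpace Ω)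
    (V : Ω → ℝ) (F : Set Ω) (ν : Ω → Measure ℝ) : Prop :=
  ∀ A : Set ℝ, MeasurableSet A →
    ∀ᵐ ω ∂μ, ω ∈ F → (μ⟦V ⁻¹' A | m⟧) ω = (ν ω).real A

end

/-!
Stein's equation for a smoothed indicator of width `ε`, evaluated along the Stein coupling, bounds
the Kolmogorov distance of `W` to the normal law by `ε` plus error terms of order `1 / r`, except
for one: since the derivative of the Stein solution inherits the slope `1 / ε` of the smoothed
indicator, there remains `E |G| D² / ε` on the event that `W` is within `|D|` of an interval of
length `ε`. On the good events this event can be enlarged to one on which `V` lies in a random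
interval that is measurable with respect to `ℱ θ`, of length `ε` plus multiples of `Dbar` and
`Bbar`. Given `ℱ θ`, the variable `V` is distributed as `Y` under the random parameter `Ψ`, hence
is itself nearly normal up to the Kolmogorov distance at `Ψ`. With `ε` a large multiple of `1 / r`
this gives a self-improving inequality `δ θ ≤ B / r θ + Δ / (2 * c)`, where `Δ` bounds `δ ψ` for all
`ψ` with `r θ ≤ c * r ψ`; iterating it from `δ ≤ 1` yields `δ θ ≤ 2 * B / r θ`.
-/

noncomputable section

section KolmogorovDistance

/-- The Kolmogorov (uniform) distance between the distribution functions of two measures on `ℝ`;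
it is a junk value `0` if the differences are unbounded, which cannot happen for finite measures. -/
def kolmogorovDist (μ ν : Measure ℝ) : ℝ :=
  ⨆ z, |μ.real (Set.Iic z) - ν.real (Set.Iic z)|

lemma kolmogorovDist_le {μ ν : Measure ℝ} {B : ℝ}
    (h : ∀ z, |μ.real (Set.Iic z) - ν.real (Set.Iic z)| ≤ B) : kolmogorovDist μ ν ≤ B :=
  ciSup_le h

lemma kolmogorovDist_le_one (μ ν : Measure ℝ) [IsProbabilityMeasure μ] [IsProbabilityMeasure ν] :
    kolmogorovDist μ ν ≤ 1 :=
  kolmogorovDist_le fun _ => abs_sub_le_of_nonneg_of_le measureReal_nonneg measureReal_le_one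
    measureReal_nonneg measureReal_le_one

lemma abs_sub_le_kolmogorovDist (μ ν : Measure ℝ) [IsFiniteMeasure μ] [IsFiniteMeasure ν] (z : ℝ) :
    |μ.real (Set.Iic z) - ν.real (Set.Iic z)| ≤ kolmogorovDist μ ν := by
  refine le_ciSup (f := fun z => |μ.real (Set.Iic z) - ν.real (Set.Iic z)|)
    ⟨μ.real Set.univ + ν.real Set.univ, ?_⟩ z
  rintro _ ⟨y, rfl⟩
  refine (abs_sub _ _).trans ?_
  rw [abs_of_nonneg measureReal_nonneg, abs_of_nonneg measureReal_nonneg]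
  exact add_le_add (measureReal_mono (Set.subset_univ _)) (measureReal_mono (Set.subset_univ _))

lemma measureReal_Ioc_eq_sub {μ : Measure ℝ} [IsFiniteMeasure μ] {a b : ℝ} (hab : a ≤ b) :
    μ.real (Set.Ioc a b) = μ.real (Set.Iic b) - μ.real (Set.Iic a) := by
  rw [← Set.Iic_sdiff_Iic, measureReal_sdiff (Set.Iic_subset_Iic.mpr hab) measurableSet_Iic]

lemma measureReal_Ioc_le_add_kolmogorovDist (μ ν : Measure ℝ) [IsFiniteMeasure μ]
    [IsFiniteMeasure ν] {a b : ℝ} (hab : a ≤ b) :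
    μ.real (Set.Ioc a b) ≤ ν.real (Set.Ioc a b) + 2 * kolmogorovDist μ ν := by
  rw [measureReal_Ioc_eq_sub hab, measureReal_Ioc_eq_sub hab]
  linarith [abs_le.mp (abs_sub_le_kolmogorovDist μ ν a),
    abs_le.mp (abs_sub_le_kolmogorovDist μ ν b)]

lemma gaussianPDF_zero_one_le_one (x : ℝ) : gaussianPDF 0 1 x ≤ 1 := by
  rw [gaussianPDF, ENNReal.ofReal_le_one, gaussianPDFReal, NNReal.coe_one, mul_one]
  refine mul_le_one₀ (inv_le_one_of_one_le₀ (Real.one_le_sqrt.mpr ?_)) (Real.exp_pos _).le ?_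
  · linarith [Real.pi_gt_three]
  · exact Real.exp_le_one_iff.mpr
      (div_nonpos_of_nonpos_of_nonneg (neg_nonpos.mpr (sq_nonneg _)) (by norm_num))

lemma gaussianReal_real_Ioc_le {a b : ℝ} (hab : a ≤ b) :
    (gaussianReal 0 1).real (Set.Ioc a b) ≤ b - a := by
  refine ENNReal.toReal_le_of_le_ofReal (sub_nonneg.mpr hab) ?_
  calc gaussianReal 0 1 (Set.Ioc a b) = ∫⁻ x in Set.Ioc a b, gaussianPDF 0 1 x :=
        gaussianReal_apply _ one_ne_zero _
    _ ≤ ∫⁻ _ in Set.Ioc a b, 1 := lintegral_mono gaussianPDF_zero_one_le_one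
    _ = ENNReal.ofReal (b - a) := by rw [setLIntegral_one, Real.volume_Ioc]

lemma measureReal_map_affine_Ioc_le {ρ : Measure ℝ} [IsFiniteMeasure ρ] {a : ℝ} (ha : 0 < a)
    (b : ℝ) {u v : ℝ} (huv : u ≤ v) :
    (ρ.map fun x => a * x + b).real (Set.Ioc u v) ≤
      (v - u) / a + 2 * kolmogorovDist ρ (gaussianReal 0 1) := by
  have hpre : (fun x => a * x + b) ⁻¹' Set.Ioc u v = Set.Ioc ((u - b) / a) ((v - b) / a) := by
    ext x
    simp only [Set.mem_preimage, Set.mem_Ioc, div_lt_iff₀' ha, le_div_iff₀' ha,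
      sub_lt_iff_lt_add, le_sub_iff_add_le]
  have hle : (u - b) / a ≤ (v - b) / a := by gcongr
  rw [map_measureReal_apply (by fun_prop) measurableSet_Ioc, hpre]
  calc ρ.real (Set.Ioc ((u - b) / a) ((v - b) / a))
      ≤ (gaussianReal 0 1).real (Set.Ioc ((u - b) / a) ((v - b) / a)) +
          2 * kolmogorovDist ρ (gaussianReal 0 1) := measureReal_Ioc_le_add_kolmogorovDist _ _ hle
    _ ≤ ((v - b) / a - (u - b) / a) + 2 * kolmogorovDist ρ (gaussianReal 0 1) := by
        gcongr
        exact gaussianReal_real_Ioc_le hle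
    _ = (v - u) / a + 2 * kolmogorovDist ρ (gaussianReal 0 1) := by ring

end KolmogorovDistance

section Ramp

variable {z ε x : ℝ}

/-- The continuous approximation of the indicator function of `(-∞, z]` which decreases linearly
from `1` to `0` on `[z, z + ε]`. -/
def ramp (z ε x : ℝ) : ℝ := max (1 - max ((x - z) / ε) 0) 0

@[fun_prop]
lemma continuous_ramp (z ε : ℝ) : Continuous (ramp z ε) := by
  unfold ramp
  fun_prop

lemma ramp_mem_Icc (z ε x : ℝ) : ramp z ε x ∈ Set.Icc 0 1 :=
  ⟨le_max_right _ _, max_le (sub_le_self _ (le_max_right _ _)) zero_le_one⟩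

lemma ramp_of_le (hε : 0 < ε) (hx : x ≤ z) : ramp z ε x = 1 := by
  rw [ramp, max_eq_right (div_nonpos_of_nonpos_of_nonneg (sub_nonpos.mpr hx) hε.le), sub_zero,
    max_eq_left zero_le_one]

lemma ramp_of_ge (hε : 0 < ε) (hx : z + ε ≤ x) : ramp z ε x = 0 :=
  max_eq_right <| sub_nonpos.mpr <| le_max_of_le_left <| by rw [one_le_div hε]; linarith

lemma integrable_ramp (μ : Measure ℝ) [IsFiniteMeasure μ] (z ε : ℝ) : Integrable (ramp z ε) μ :=
  .of_mem_Icc 0 1 (continuous_ramp z ε).aemeasurable (.of_forall (ramp_mem_Icc z ε))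

lemma abs_ramp_sub_ramp_le_div (hε : 0 < ε) (x y : ℝ) :
    |ramp z ε y - ramp z ε x| ≤ |y - x| / ε :=
  calc |ramp z ε y - ramp z ε x|
      ≤ |(1 - max ((y - z) / ε) 0) - (1 - max ((x - z) / ε) 0)| := abs_max_sub_max_le_abs _ _ _
    _ = |max ((y - z) / ε) 0 - max ((x - z) / ε) 0| := by
      rw [sub_sub_sub_cancel_left, abs_sub_comm]
    _ ≤ |(y - z) / ε - (x - z) / ε| := abs_max_sub_max_le_abs _ _ _
    _ = |y - x| / ε := by rw [← sub_div, sub_sub_sub_cancel_right, abs_div, abs_of_pos hε]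

lemma abs_ramp_add_sub_ramp_le (hε : 0 < ε) {t d : ℝ} (ht : |t| ≤ d) :
    |ramp z ε (x + t) - ramp z ε x| ≤
      (Set.Ioc (z - d) (z + ε + d)).indicator (fun _ => min 1 (d / ε)) x := by
  have ht' := abs_le.mp ht
  by_cases hx : x ∈ Set.Ioc (z - d) (z + ε + d)
  · rw [Set.indicator_of_mem hx]
    refine le_min ?_ ((abs_ramp_sub_ramp_le_div hε _ _).trans ?_)
    · exact abs_sub_le_of_nonneg_of_le (ramp_mem_Icc ..).1 (ramp_mem_Icc ..).2
        (ramp_mem_Icc ..).1 (ramp_mem_Icc ..).2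
    · rw [add_sub_cancel_left]
      gcongr
  · rw [Set.indicator_of_notMem hx]
    rw [Set.mem_Ioc, not_and_or, not_lt, not_le] at hx
    rcases hx with hx | hx
    · rw [ramp_of_le hε (by linarith), ramp_of_le hε (by linarith), sub_self, abs_zero]
    · rw [ramp_of_ge hε (by linarith), ramp_of_ge hε (by linarith), sub_self, abs_zero]

lemma measureReal_Iic_le_integral_ramp (μ : Measure ℝ) [IsFiniteMeasure μ] (hε : 0 < ε) :
    μ.real (Set.Iic z) ≤ ∫ x, ramp z ε x ∂μ := by
  rw [← integral_indicator_one measurableSet_Iic]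
  refine integral_mono ((integrable_const _).indicator measurableSet_Iic)
    (integrable_ramp μ z ε) (Set.indicator_le' (fun x hx => ?_) fun x _ => (ramp_mem_Icc z ε x).1)
  exact (ramp_of_le hε hx).ge

lemma integral_ramp_le_measureReal_Iic (μ : Measure ℝ) [IsFiniteMeasure μ] (hε : 0 < ε) :
    ∫ x, ramp z ε x ∂μ ≤ μ.real (Set.Iic (z + ε)) := by
  rw [← integral_indicator_one measurableSet_Iic]
  refine integral_mono (integrable_ramp μ z ε) ((integrable_const _).indicator measurableSet_Iic)
    (Set.le_indicator (fun x _ => (ramp_mem_Icc z ε x).2) fun x hx => ?_)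
  exact (ramp_of_ge hε (not_le.mp hx).le).le

lemma kolmogorovDist_le_of_integral_ramp {μ ν : Measure ℝ} [IsFiniteMeasure μ]
    [IsFiniteMeasure ν] {B η : ℝ} (hε : 0 < ε)
    (hB : ∀ z, |∫ x, ramp z ε x ∂μ - ∫ x, ramp z ε x ∂ν| ≤ B)
    (hν : ∀ z, ν.real (Set.Ioc z (z + ε)) ≤ η) :
    kolmogorovDist μ ν ≤ B + η := by
  refine kolmogorovDist_le fun z => abs_le.mpr ⟨?_, ?_⟩
  · have hμ_lower := integral_ramp_le_measureReal_Iic (z := z - ε) μ hε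
    have hν_upper := measureReal_Iic_le_integral_ramp (z := z - ε) ν hε
    have hν_Ioc := hν (z - ε)
    rw [measureReal_Ioc_eq_sub (by linarith)] at hν_Ioc
    rw [sub_add_cancel] at hμ_lower hν_Ioc
    linarith [abs_le.mp (hB (z - ε))]
  · have hμ_upper := measureReal_Iic_le_integral_ramp (z := z) μ hε
    have hν_lower := integral_ramp_le_measureReal_Iic (z := z) ν hε
    have hν_Ioc := hν z
    rw [measureReal_Ioc_eq_sub (by linarith)] at hν_Ioc
    linarith [abs_le.mp (hB z)]

end Ramp

section MillsRatio

lemma integrable_exp_neg_sq_div_two : Integrable fun t : ℝ => Real.exp (-t ^ 2 / 2) := by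
  simpa only [neg_mul, one_div, inv_mul_eq_div, neg_div] using
    integrable_exp_neg_mul_sq one_half_pos

lemma integral_exp_neg_sq_div_two_le : ∫ t : ℝ, Real.exp (-t ^ 2 / 2) ≤ 3 := by
  have hgauss : ∫ t : ℝ, Real.exp (-t ^ 2 / 2) = √(Real.pi / (1 / 2)) := by
    simpa only [neg_mul, one_div, inv_mul_eq_div, neg_div] using integral_gaussian (1 / 2)
  rw [hgauss, Real.sqrt_le_left (by norm_num)]
  linarith [Real.pi_lt_d2]

/-- The Mills ratio `(1 - Φ(y)) / φ(y)` of the standard normal distribution, with distribution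
function `Φ` and density `φ`; it governs the size of the solutions of Stein's equation. -/
def millsRatio (y : ℝ) : ℝ :=
  Real.exp (y ^ 2 / 2) * ∫ t in Set.Ioi y, Real.exp (-t ^ 2 / 2)

lemma millsRatio_nonneg (y : ℝ) : 0 ≤ millsRatio y :=
  mul_nonneg (Real.exp_pos _).le (integral_nonneg fun _ => (Real.exp_pos _).le)

lemma exp_sq_div_two_mul_exp_neg_sq_div_two (x : ℝ) :
    Real.exp (x ^ 2 / 2) * Real.exp (-x ^ 2 / 2) = 1 := by
  rw [← Real.exp_add, neg_div, add_neg_cancel, Real.exp_zero]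

lemma millsRatio_le_three {y : ℝ} (hy : 0 ≤ y) : millsRatio y ≤ 3 := by
  have hshift : Integrable fun t : ℝ => Real.exp (-(t - y) ^ 2 / 2) :=
    integrable_exp_neg_sq_div_two.comp_sub_right y
  have htail : ∫ t in Set.Ioi y, Real.exp (-t ^ 2 / 2) ≤ Real.exp (-y ^ 2 / 2) * 3 := calc
    ∫ t in Set.Ioi y, Real.exp (-t ^ 2 / 2)
        ≤ ∫ t in Set.Ioi y, Real.exp (-y ^ 2 / 2) * Real.exp (-(t - y) ^ 2 / 2) := by
      refine setIntegral_mono_on integrable_exp_neg_sq_div_two.integrableOn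
        (hshift.const_mul _).integrableOn measurableSet_Ioi fun t (ht : y < t) => ?_
      rw [← Real.exp_add, Real.exp_le_exp]
      nlinarith
    _ = Real.exp (-y ^ 2 / 2) * ∫ t in Set.Ioi y, Real.exp (-(t - y) ^ 2 / 2) :=
      integral_const_mul _ _
    _ ≤ Real.exp (-y ^ 2 / 2) * 3 := by
      gcongr
      refine (setIntegral_le_integral hshift (.of_forall fun _ => (Real.exp_pos _).le)).trans ?_
      rw [integral_sub_right_eq_self fun t : ℝ => Real.exp (-t ^ 2 / 2)]
      exact integral_exp_neg_sq_div_two_le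
  calc millsRatio y ≤ Real.exp (y ^ 2 / 2) * (Real.exp (-y ^ 2 / 2) * 3) := by
        unfold millsRatio
        gcongr
    _ = 3 := by rw [← mul_assoc, exp_sq_div_two_mul_exp_neg_sq_div_two, one_mul]

lemma mul_millsRatio_le_one (y : ℝ) : y * millsRatio y ≤ 1 := by
  rcases le_or_gt y 0 with hy | hy
  · exact (mul_nonpos_of_nonpos_of_nonneg hy (millsRatio_nonneg y)).trans zero_le_one
  have htail : ∫ t in Set.Ioi y, Real.exp (-t ^ 2 / 2) ≤ Real.exp (-y ^ 2 / 2) / y := calc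
    ∫ t in Set.Ioi y, Real.exp (-t ^ 2 / 2)
        ≤ ∫ t in Set.Ioi y, Real.exp (y ^ 2 / 2) * Real.exp (-y * t) := by
      refine setIntegral_mono_on integrable_exp_neg_sq_div_two.integrableOn
        ((integrableOn_exp_mul_Ioi (neg_lt_zero.mpr hy) y).const_mul _) measurableSet_Ioi
        fun t _ => ?_
      rw [← Real.exp_add, Real.exp_le_exp]
      nlinarith [sq_nonneg (t - y)]
    _ = Real.exp (y ^ 2 / 2) * Real.exp (-y * y) / y := by
      rw [integral_const_mul, integral_exp_mul_Ioi (neg_lt_zero.mpr hy), neg_div_neg_eq,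
        mul_div_assoc]
    _ = Real.exp (-y ^ 2 / 2) / y := by
      rw [← Real.exp_add]
      ring_nf
  calc y * millsRatio y ≤ y * (Real.exp (y ^ 2 / 2) * (Real.exp (-y ^ 2 / 2) / y)) := by
        unfold millsRatio
        gcongr
    _ = 1 := by
        rw [← mul_div_assoc, exp_sq_div_two_mul_exp_neg_sq_div_two, mul_one_div_cancel hy.ne']

end MillsRatio

section SteinEquation

lemma integral_gaussianReal_zero_one (h : ℝ → ℝ) :
    ∫ x, h x ∂(gaussianReal 0 1) = (√(2 * Real.pi))⁻¹ * ∫ x, h x * Real.exp (-x ^ 2 / 2) := by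
  simp only [integral_gaussianReal_eq_integral_smul one_ne_zero, gaussianPDFReal, sub_zero,
    NNReal.coe_one, mul_one, smul_eq_mul, ← integral_const_mul, mul_assoc, mul_comm (h _)]

lemma hasDerivAt_integral_Iic {E : Type*} [NormedAddCommGroup E] [NormedSpace ℝ E]
    [CompleteSpace E] {g : ℝ → E} (hg : Integrable g) (hc : Continuous g) (x : ℝ) :
    HasDerivAt (fun y => ∫ t in Set.Iic y, g t) (g x) x := by
  have hsplit : (fun y => ∫ t in Set.Iic y, g t) =
      fun y => (∫ t in Set.Iic 0, g t) + ∫ t in 0..y, g t := by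
    ext y
    rw [← intervalIntegral.integral_Iic_sub_Iic hg.integrableOn hg.integrableOn,
      add_sub_cancel]
  rw [hsplit]
  exact (intervalIntegral.integral_hasDerivAt_right (hc.intervalIntegrable _ _)
    (hc.stronglyMeasurableAtFilter _ _) hc.continuousAt).const_add _

lemma integrable_of_abs_sub_const_le {α : Type*} [MeasurableSpace α] {μ : Measure α}
    [IsFiniteMeasure μ] {f : α → ℝ} {c M : ℝ} (hf : AEStronglyMeasurable f μ)
    (hM : ∀ x, |f x - c| ≤ M) : Integrable f μ :=
  .of_bound hf (M + |c|) <| .of_forall fun x => by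
    rw [Real.norm_eq_abs]
    linarith [abs_sub_abs_le_abs_sub (f x) c, hM x]

/-- The bounded solution `f` of Stein's equation `f' x - x * f x = h x - ∫ h dγ`, where `γ` is the
standard normal distribution. -/
def steinSolution (h : ℝ → ℝ) (x : ℝ) : ℝ :=
  Real.exp (x ^ 2 / 2) *
    ∫ t in Set.Iic x, (h t - ∫ y, h y ∂(gaussianReal 0 1)) * Real.exp (-t ^ 2 / 2)

/-- The derivative of `steinSolution h`, read off Stein's equation. -/
def steinSolutionDeriv (h : ℝ → ℝ) (x : ℝ) : ℝ :=
  x * steinSolution h x + (h x - ∫ y, h y ∂(gaussianReal 0 1))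

variable {h : ℝ → ℝ} {M : ℝ}

lemma integrable_sub_mul_exp_neg_sq (hc : Continuous h)
    (hM : ∀ x, |h x - ∫ y, h y ∂(gaussianReal 0 1)| ≤ M) :
    Integrable fun t => (h t - ∫ y, h y ∂(gaussianReal 0 1)) * Real.exp (-t ^ 2 / 2) :=
  integrable_exp_neg_sq_div_two.bdd_mul (by fun_prop) (.of_forall hM)

lemma integral_sub_mul_exp_neg_sq_eq_zero (hh : Integrable h (gaussianReal 0 1)) :
    ∫ t, (h t - ∫ y, h y ∂(gaussianReal 0 1)) * Real.exp (-t ^ 2 / 2) = 0 := by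
  have hzero : ∫ t, (h t - ∫ y, h y ∂(gaussianReal 0 1)) ∂(gaussianReal 0 1) = 0 := by
    rw [integral_sub hh (integrable_const _), integral_const, probReal_univ, one_smul, sub_self]
  rw [integral_gaussianReal_zero_one] at hzero
  exact (mul_eq_zero.mp hzero).resolve_left (by positivity)

lemma hasDerivAt_steinSolution (hc : Continuous h)
    (hM : ∀ x, |h x - ∫ y, h y ∂(gaussianReal 0 1)| ≤ M) (x : ℝ) :
    HasDerivAt (steinSolution h) (steinSolutionDeriv h x) x := by
  have hexp : HasDerivAt (fun x : ℝ => Real.exp (x ^ 2 / 2)) (Real.exp (x ^ 2 / 2) * x) x := by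
    simpa using ((hasDerivAt_pow 2 x).div_const 2).exp
  refine (hexp.fun_mul (hasDerivAt_integral_Iic (integrable_sub_mul_exp_neg_sq hc hM)
    (by fun_prop) x)).congr_deriv ?_
  rw [steinSolutionDeriv, steinSolution]
  linear_combination (h x - ∫ y, h y ∂(gaussianReal 0 1)) *
    exp_sq_div_two_mul_exp_neg_sq_div_two x

lemma continuous_steinSolution (hc : Continuous h)
    (hM : ∀ x, |h x - ∫ y, h y ∂(gaussianReal 0 1)| ≤ M) : Continuous (steinSolution h) :=
  continuous_iff_continuousAt.mpr fun x => (hasDerivAt_steinSolution hc hM x).continuousAt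

lemma continuous_steinSolutionDeriv (hc : Continuous h)
    (hM : ∀ x, |h x - ∫ y, h y ∂(gaussianReal 0 1)| ≤ M) : Continuous (steinSolutionDeriv h) :=
  (continuous_id.mul (continuous_steinSolution hc hM)).add (hc.sub continuous_const)

lemma abs_steinSolution_le_mul_millsRatio (hc : Continuous h)
    (hM : ∀ x, |h x - ∫ y, h y ∂(gaussianReal 0 1)| ≤ M) (x : ℝ) :
    |steinSolution h x| ≤ M * millsRatio |x| := by
  have hg := integrable_sub_mul_exp_neg_sq hc hM
  set g := fun t => (h t - ∫ y, h y ∂(gaussianReal 0 1)) * Real.exp (-t ^ 2 / 2)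
  have hset (s : Set ℝ) : |∫ t in s, g t| ≤ M * ∫ t in s, Real.exp (-t ^ 2 / 2) := by
    rw [← integral_const_mul, ← Real.norm_eq_abs]
    refine norm_integral_le_of_norm_le (integrable_exp_neg_sq_div_two.const_mul M).integrableOn
      (.of_forall fun t => ?_)
    rw [norm_mul, Real.norm_eq_abs, Real.norm_eq_abs, Real.abs_exp]
    gcongr
    exact hM t
  have htail : |∫ t in Set.Iic x, g t| ≤ M * ∫ t in Set.Ioi |x|, Real.exp (-t ^ 2 / 2) := by
    rcases le_total x 0 with hx | hx
    · rw [abs_of_nonpos hx, ← integral_comp_neg_Iic x fun t : ℝ => Real.exp (-t ^ 2 / 2)]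
      simpa only [neg_sq] using hset (Set.Iic x)
    · have hsum := intervalIntegral.integral_Iic_add_Ioi (b := x) hg.integrableOn hg.integrableOn
      rw [integral_sub_mul_exp_neg_sq_eq_zero
        (integrable_of_abs_sub_const_le hc.aestronglyMeasurable hM)] at hsum
      rw [abs_of_nonneg hx, eq_neg_of_add_eq_zero_left hsum, abs_neg]
      exact hset (Set.Ioi x)
  rw [steinSolution, millsRatio, abs_mul, Real.abs_exp, sq_abs, mul_left_comm]
  gcongr

lemma abs_steinSolution_le (hc : Continuous h)
    (hM : ∀ x, |h x - ∫ y, h y ∂(gaussianReal 0 1)| ≤ M) (x : ℝ) :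
    |steinSolution h x| ≤ 3 * M := by
  have hM0 : 0 ≤ M := (abs_nonneg _).trans (hM 0)
  refine (abs_steinSolution_le_mul_millsRatio hc hM x).trans ?_
  rw [mul_comm 3 M]
  gcongr
  exact millsRatio_le_three (abs_nonneg x)

lemma abs_mul_steinSolution_le (hc : Continuous h)
    (hM : ∀ x, |h x - ∫ y, h y ∂(gaussianReal 0 1)| ≤ M) (x : ℝ) :
    |x * steinSolution h x| ≤ M := by
  have hM0 : 0 ≤ M := (abs_nonneg _).trans (hM 0)
  calc |x * steinSolution h x| = |x| * |steinSolution h x| := abs_mul _ _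
    _ ≤ |x| * (M * millsRatio |x|) := by
      gcongr
      exact abs_steinSolution_le_mul_millsRatio hc hM x
    _ = M * (|x| * millsRatio |x|) := mul_left_comm _ _ _
    _ ≤ M := mul_le_of_le_one_right hM0 (mul_millsRatio_le_one |x|)

lemma abs_steinSolutionDeriv_le (hc : Continuous h)
    (hM : ∀ x, |h x - ∫ y, h y ∂(gaussianReal 0 1)| ≤ M) (x : ℝ) :
    |steinSolutionDeriv h x| ≤ 2 * M :=
  (abs_add_le _ _).trans (by linarith [abs_mul_steinSolution_le hc hM x, hM x])

lemma abs_steinSolution_sub_le (hc : Continuous h)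
    (hM : ∀ x, |h x - ∫ y, h y ∂(gaussianReal 0 1)| ≤ M) (x y : ℝ) :
    |steinSolution h y - steinSolution h x| ≤ 2 * M * |y - x| :=
  convex_univ.norm_image_sub_le_of_norm_hasDerivWithin_le
    (fun u _ => (hasDerivAt_steinSolution hc hM u).hasDerivWithinAt)
    (fun u _ => abs_steinSolutionDeriv_le hc hM u) (Set.mem_univ x) (Set.mem_univ y)

lemma abs_steinSolutionDeriv_add_sub_le (hc : Continuous h)
    (hM : ∀ x, |h x - ∫ y, h y ∂(gaussianReal 0 1)| ≤ M) (x t : ℝ) :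
    |steinSolutionDeriv h (x + t) - steinSolutionDeriv h x| ≤
      3 * M * ((1 + |x|) * |t|) + |h (x + t) - h x| := by
  have hM0 : 0 ≤ M := (abs_nonneg _).trans (hM 0)
  have hsub := abs_steinSolution_sub_le hc hM x (x + t)
  rw [add_sub_cancel_left] at hsub
  calc |steinSolutionDeriv h (x + t) - steinSolutionDeriv h x|
      = |x * (steinSolution h (x + t) - steinSolution h x) + t * steinSolution h (x + t) +
          (h (x + t) - h x)| := by rw [steinSolutionDeriv, steinSolutionDeriv]; ring_nf
    _ ≤ |x| * |steinSolution h (x + t) - steinSolution h x| + |t| * |steinSolution h (x + t)| +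
          |h (x + t) - h x| := by
      simpa only [abs_mul] using abs_add_three (x * (steinSolution h (x + t) - steinSolution h x))
        (t * steinSolution h (x + t)) (h (x + t) - h x)
    _ ≤ |x| * (2 * M * |t|) + |t| * (3 * M) + |h (x + t) - h x| := by
      gcongr
      exact abs_steinSolution_le hc hM _
    _ ≤ 3 * M * ((1 + |x|) * |t|) + |h (x + t) - h x| := by
      nlinarith [mul_nonneg hM0 (mul_nonneg (abs_nonneg x) (abs_nonneg t))]

lemma abs_steinSolution_taylor_le (hc : Continuous h)
    (hM : ∀ x, |h x - ∫ y, h y ∂(gaussianReal 0 1)| ≤ M) {x d η : ℝ}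
    (hη : ∀ t, |t| ≤ |d| → |h (x + t) - h x| ≤ η) :
    |steinSolution h (x + d) - steinSolution h x - d * steinSolutionDeriv h x| ≤
      3 * M * ((1 + |x|) * d ^ 2) + |d| * η := by
  have hM0 : 0 ≤ M := (abs_nonneg _).trans (hM 0)
  have hderiv : ∀ u ∈ Set.uIcc x (x + d), HasDerivWithinAt
      (fun y => steinSolution h y - steinSolutionDeriv h x * y)
      (steinSolutionDeriv h u - steinSolutionDeriv h x) (Set.uIcc x (x + d)) u := fun u _ =>
    ((hasDerivAt_steinSolution hc hM u).sub
      (by simpa using (hasDerivAt_id u).const_mul (steinSolutionDeriv h x))).hasDerivWithinAt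
  have hbound : ∀ u ∈ Set.uIcc x (x + d), ‖steinSolutionDeriv h u - steinSolutionDeriv h x‖ ≤
      3 * M * ((1 + |x|) * |d|) + η := fun u hu => by
    have hux : |u - x| ≤ |d| := by simpa using Set.abs_sub_left_of_mem_uIcc hu
    have hadd := abs_steinSolutionDeriv_add_sub_le hc hM x (u - x)
    rw [add_sub_cancel] at hadd
    refine hadd.trans ?_
    gcongr
    simpa using hη _ hux
  have hmvt := (convex_uIcc x (x + d)).norm_image_sub_le_of_norm_hasDerivWithin_le hderiv hbound
    Set.left_mem_uIcc Set.right_mem_uIcc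
  rw [Real.norm_eq_abs, Real.norm_eq_abs, add_sub_cancel_left] at hmvt
  calc |steinSolution h (x + d) - steinSolution h x - d * steinSolutionDeriv h x|
      = |steinSolution h (x + d) - steinSolutionDeriv h x * (x + d) -
          (steinSolution h x - steinSolutionDeriv h x * x)| := by ring_nf
    _ ≤ (3 * M * ((1 + |x|) * |d|) + η) * |d| := hmvt
    _ = 3 * M * ((1 + |x|) * d ^ 2) + |d| * η := by rw [← sq_abs d]; ring

end SteinEquation

section PosExp

variable {Ω : Type*} {m mΩ : MeasurableSpace Ω} {μ : Measure Ω} {X X' : Ω → ℝ}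

lemma posExp_mono_ae (h : ∀ᵐ ω ∂μ, X ω ≤ X' ω) : posExp μ X ≤ posExp μ X' :=
  lintegral_mono_ae <| h.mono fun _ => ENNReal.ofReal_le_ofReal

lemma posExp_add_le (hX : AEMeasurable X μ) :
    posExp μ (fun ω => X ω + X' ω) ≤ posExp μ X + posExp μ X' :=
  calc posExp μ (fun ω => X ω + X' ω)
      ≤ ∫⁻ ω, (ENNReal.ofReal (X ω) + ENNReal.ofReal (X' ω)) ∂μ :=
        lintegral_mono fun _ => ENNReal.ofReal_add_le
    _ = posExp μ X + posExp μ X' := lintegral_add_left' hX.ennreal_ofReal _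

lemma posExp_const_mul {c : ℝ} (hc : 0 ≤ c) :
    posExp μ (fun ω => c * X ω) = ENNReal.ofReal c * posExp μ X := by
  simp only [posExp, ENNReal.ofReal_mul hc]
  exact lintegral_const_mul' _ _ ENNReal.ofReal_ne_top

lemma ofReal_abs_integral_le_posExp_abs :
    ENNReal.ofReal |∫ ω, X ω ∂μ| ≤ posExp μ (fun ω => |X ω|) := by
  simpa only [posExp, Real.enorm_eq_ofReal_abs] using enorm_integral_le_lintegral_enorm X

lemma ofReal_abs_integral_mul_le_posExp_condExp [IsFiniteMeasure μ] (hm : m ≤ mΩ)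
    {φ : Ω → ℝ} {c : ℝ} (hφ : StronglyMeasurable[m] φ) (hφc : ∀ ω, |φ ω| ≤ c)
    (hX : Integrable X μ) :
    ENNReal.ofReal |∫ ω, φ ω * X ω ∂μ| ≤
      ENNReal.ofReal c * posExp μ (fun ω => |(μ[X | m]) ω|) := by
  have hφX : Integrable (fun ω => φ ω * X ω) μ :=
    hX.bdd_mul (hφ.mono hm).aestronglyMeasurable (.of_forall hφc)
  have hcond : ∫ ω, φ ω * X ω ∂μ = ∫ ω, φ ω * (μ[X | m]) ω ∂μ := by
    rw [← integral_condExp hm]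
    exact integral_congr_ae (condExp_mul_of_stronglyMeasurable_left hφ hφX hX)
  rcases isEmpty_or_nonempty Ω with _ | ⟨⟨ω₀⟩⟩
  · simp [integral_of_isEmpty]
  rw [hcond, ← posExp_const_mul ((abs_nonneg _).trans (hφc ω₀))]
  refine ofReal_abs_integral_le_posExp_abs.trans (posExp_mono_ae (.of_forall fun ω => ?_))
  rw [abs_mul]
  gcongr
  exact hφc ω

end PosExp

section SteinCoupling

variable {Ω : Type*} [MeasurableSpace Ω] {μ : Measure Ω}
  {W W' G : Ω → ℝ} {h : ℝ → ℝ} {M : ℝ}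

lemma integrable_mul_steinSolution_sub (hW : Measurable W) (hW' : Measurable W')
    (hG : Measurable G) (hGD : Integrable (fun ω => G ω * (W' ω - W ω)) μ) (hc : Continuous h)
    (hM : ∀ x, |h x - ∫ y, h y ∂(gaussianReal 0 1)| ≤ M) :
    Integrable (fun ω => G ω * steinSolution h (W' ω) - G ω * steinSolution h (W ω)) μ := by
  have hf := (continuous_steinSolution hc hM).measurable
  refine (hGD.norm.const_mul (2 * M)).mono' (by fun_prop) (.of_forall fun ω => ?_)
  rw [← mul_sub, norm_mul, norm_mul, mul_left_comm]
  gcongr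
  exact abs_steinSolution_sub_le hc hM (W ω) (W' ω)

lemma integrable_steinSolutionDeriv_comp [IsFiniteMeasure μ] (hW : Measurable W) (hc : Continuous h)
    (hM : ∀ x, |h x - ∫ y, h y ∂(gaussianReal 0 1)| ≤ M) :
    Integrable (fun ω => steinSolutionDeriv h (W ω)) μ :=
  .of_bound ((continuous_steinSolutionDeriv hc hM).measurable.comp hW).aestronglyMeasurable
    (2 * M) (.of_forall fun ω => abs_steinSolutionDeriv_le hc hM (W ω))

lemma integral_comp_sub_integral_gaussianReal_eq [IsProbabilityMeasure μ] (hW : Measurable W)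
    (hc : Continuous h) (hM : ∀ x, |h x - ∫ y, h y ∂(gaussianReal 0 1)| ≤ M) :
    ∫ ω, h (W ω) ∂μ - ∫ y, h y ∂(gaussianReal 0 1) =
      ∫ ω, steinSolutionDeriv h (W ω) ∂μ - ∫ ω, W ω * steinSolution h (W ω) ∂μ := by
  have hf := (continuous_steinSolution hc hM).measurable
  have hWf : Integrable (fun ω => W ω * steinSolution h (W ω)) μ :=
    .of_bound (by fun_prop) M (.of_forall fun ω => abs_mul_steinSolution_le hc hM (W ω))
  have hhN : Integrable (fun ω => h (W ω) - ∫ y, h y ∂(gaussianReal 0 1)) μ :=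
    .of_bound (by fun_prop) M (.of_forall fun ω => hM (W ω))
  have hh : Integrable (fun ω => h (W ω)) μ :=
    integrable_of_abs_sub_const_le (by fun_prop) fun ω => hM (W ω)
  simp only [steinSolutionDeriv]
  rw [integral_add hWf hhN, integral_sub hh (integrable_const _), integral_const, probReal_univ,
    one_smul, add_sub_cancel_left]

variable [IsProbabilityMeasure μ]

/-- The remainder of the second-order Taylor expansion of `steinSolution h` from `x` to `y`. -/
def steinRemainder (h : ℝ → ℝ) (x y : ℝ) : ℝ :=
  steinSolution h y - steinSolution h x - (y - x) * steinSolutionDeriv h x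

lemma IsSteinCoupling.integral_sub_integral_gaussianReal_eq (hS : IsSteinCoupling μ W W' G)
    (hW : Measurable W) (hW' : Measurable W') (hG : Measurable G)
    (hGD : Integrable (fun ω => G ω * (W' ω - W ω)) μ) (hc : Continuous h)
    (hM : ∀ x, |h x - ∫ y, h y ∂(gaussianReal 0 1)| ≤ M) :
    ∫ ω, h (W ω) ∂μ - ∫ y, h y ∂(gaussianReal 0 1) =
      ∫ ω, steinSolutionDeriv h (W ω) * (1 - G ω * (W' ω - W ω)) ∂μ -
        ∫ ω, G ω * steinRemainder h (W ω) (W' ω) ∂μ := by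
  have hf := (continuous_steinSolution hc hM).measurable
  have hGf := integrable_mul_steinSolution_sub hW hW' hG hGD hc hM
  have hf' := integrable_steinSolutionDeriv_comp (μ := μ) hW hc hM
  have hWf : Integrable (fun ω => W ω * steinSolution h (W ω)) μ :=
    .of_bound (by fun_prop) M (.of_forall fun ω => abs_mul_steinSolution_le hc hM (W ω))
  have hf'D : Integrable
      (fun ω => steinSolutionDeriv h (W ω) * (1 - G ω * (W' ω - W ω))) μ :=
    ((integrable_const 1).sub hGD).bdd_mul hf'.aestronglyMeasurable
      (.of_forall fun ω => abs_steinSolutionDeriv_le hc hM (W ω))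
  have hremainder : ∫ ω, G ω * steinRemainder h (W ω) (W' ω) ∂μ =
      ∫ ω, W ω * steinSolution h (W ω) ∂μ - (∫ ω, steinSolutionDeriv h (W ω) ∂μ -
        ∫ ω, steinSolutionDeriv h (W ω) * (1 - G ω * (W' ω - W ω)) ∂μ) := by
    rw [← hS _ hf hGf hWf, ← integral_sub hf' hf'D, ← integral_sub hGf (hf'.sub' hf'D)]
    refine integral_congr_ae (.of_forall fun ω => ?_)
    simp only [steinRemainder]
    ring
  rw [integral_comp_sub_integral_gaussianReal_eq hW hc hM, hremainder]
  ring

lemma IsSteinCoupling.ofReal_abs_integral_sub_le (hS : IsSteinCoupling μ W W' G)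
    (hW : Measurable W) (hW' : Measurable W') (hG : Measurable G)
    (hGD : Integrable (fun ω => G ω * (W' ω - W ω)) μ) (hc : Continuous h)
    (hM : ∀ x, |h x - ∫ y, h y ∂(gaussianReal 0 1)| ≤ M) {η : Ω → ℝ}
    (hη : ∀ ω t, |t| ≤ |W' ω - W ω| → |h (W ω + t) - h (W ω)| ≤ η ω) :
    ENNReal.ofReal |∫ ω, h (W ω) ∂μ - ∫ y, h y ∂(gaussianReal 0 1)| ≤
      ENNReal.ofReal (2 * M) * posExp μ (fun ω =>
        |(μ[fun ω' => 1 - G ω' * (W' ω' - W ω') | MeasurableSpace.comap W inferInstance]) ω|) +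
      (ENNReal.ofReal (3 * M) *
        posExp μ (fun ω => (1 + |W ω|) * |G ω| * (W' ω - W ω) ^ 2) +
      posExp μ (fun ω => |G ω| * (|W' ω - W ω| * η ω))) := by
  have hM0 : 0 ≤ M := (abs_nonneg _).trans (hM 0)
  rw [hS.integral_sub_integral_gaussianReal_eq hW hW' hG hGD hc hM]
  refine (ENNReal.ofReal_le_ofReal (abs_sub _ _)).trans (ENNReal.ofReal_add_le.trans ?_)
  refine add_le_add ?_ (ofReal_abs_integral_le_posExp_abs.trans ?_)
  · exact ofReal_abs_integral_mul_le_posExp_condExp hW.comap_le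
      ((continuous_steinSolutionDeriv hc hM).measurable.comp
        (comap_measurable W)).stronglyMeasurable
      (fun ω => abs_steinSolutionDeriv_le hc hM (W ω)) ((integrable_const 1).sub hGD)
  · rw [← posExp_const_mul (by positivity)]
    refine (posExp_mono_ae (.of_forall fun ω => ?_)).trans (posExp_add_le (by fun_prop))
    have htaylor := abs_steinSolution_taylor_le hc hM (hη ω)
    rw [add_sub_cancel] at htaylor
    calc |G ω * steinRemainder h (W ω) (W' ω)|
        ≤ |G ω| * (3 * M * ((1 + |W ω|) * (W' ω - W ω) ^ 2) + |W' ω - W ω| * η ω) := by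
          rw [abs_mul, steinRemainder]
          gcongr
      _ = _ := by ring

end SteinCoupling

section ConditionalLaw

variable {Ω : Type*} {m mΩ : MeasurableSpace Ω} {μ : Measure Ω} {V : Ω → ℝ} {E F : Set Ω}
  {ν : Ω → Measure ℝ}

lemma HasCondLawOn.mono (h : HasCondLawOn μ m V F ν) (hEF : E ⊆ F) : HasCondLawOn μ m V E ν :=
  fun A hA => (h A hA).mono fun _ hω hE => hω (hEF hE)

lemma HasCondLawOn.map (h : HasCondLawOn μ m V F ν) {φ : ℝ → ℝ} (hφ : Measurable φ) :
    HasCondLawOn μ m (fun ω => φ (V ω)) F (fun ω => (ν ω).map φ) := fun A hA => by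
  filter_upwards [h (φ ⁻¹' A) (hφ hA)] with ω hω hF
  rw [map_measureReal_apply hφ hA, ← hω hF, ← Set.preimage_comp]
  rfl

variable [IsFiniteMeasure μ]

/-- The regular conditional law of `V` given the sub-σ-algebra `m`: the conditional distribution
given the identity map, seen as a random element of the coarser space `(Ω, m)`. -/
def condLaw (μ : Measure Ω) [IsFiniteMeasure μ] (m : MeasurableSpace Ω) (V : Ω → ℝ) :
    Kernel[m, inferInstance] Ω ℝ :=
  @condDistrib Ω Ω ℝ _ _ _ mΩ m V id μ _

instance isMarkovKernel_condLaw : IsMarkovKernel (condLaw μ m V) :=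
  inferInstanceAs (IsMarkovKernel (@condDistrib Ω Ω ℝ _ _ _ mΩ m V id μ _))

lemma condLaw_ae_eq_condExp (hm : m ≤ mΩ) (hV : Measurable V) {A : Set ℝ} (hA : MeasurableSet A) :
    (fun ω => (condLaw μ m V ω).real A) =ᵐ[μ] μ⟦V ⁻¹' A | m⟧ := by
  have h := @condDistrib_ae_eq_condExp Ω Ω ℝ _ _ _ mΩ μ _ id V m A (measurable_id'' hm) hV hA
  rwa [MeasurableSpace.comap_id] at h

lemma lintegral_lintegral_condLaw (hm : m ≤ mΩ) (hV : Measurable V) {f : Ω × ℝ → ℝ≥0∞}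
    (hf : Measurable[m.prod inferInstance] f) :
    ∫⁻ ω, ∫⁻ y, f (ω, y) ∂condLaw μ m V ω ∂μ = ∫⁻ ω, f (ω, V ω) ∂μ := by
  have hid : @Measurable Ω Ω mΩ m id := measurable_id'' hm
  have hpair := @compProd_map_condDistrib Ω Ω ℝ _ _ _ mΩ μ _ id V m hV.aemeasurable
  calc ∫⁻ ω, ∫⁻ y, f (ω, y) ∂condLaw μ m V ω ∂μ
      = ∫⁻ ω, ∫⁻ y, f (ω, y) ∂condLaw μ m V ω ∂(@Measure.map Ω Ω mΩ m id μ) :=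
        (@lintegral_map Ω Ω mΩ m μ _ id hf.lintegral_kernel_prod_right' hid).symm
    _ = ∫⁻ p, f p ∂(@Measure.compProd Ω ℝ m _ (@Measure.map Ω Ω mΩ m id μ) (condLaw μ m V)) :=
        (Measure.lintegral_compProd hf).symm
    _ = ∫⁻ ω, f (ω, V ω) ∂μ := by
        rw [condLaw, hpair]
        exact @lintegral_map Ω (Ω × ℝ) mΩ (m.prod inferInstance) μ _ _ hf
          (hid.prodMk hV)

lemma measure_eq_of_forall_rat_measureReal_Iic_eq {ρ ρ' : Measure ℝ} [IsProbabilityMeasure ρ]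
    (huniv : ρ.real Set.univ = ρ'.real Set.univ)
    (h : ∀ q : ℚ, ρ.real (Set.Iic q) = ρ'.real (Set.Iic q)) : ρ = ρ' := by
  have : IsProbabilityMeasure ρ' := by
    rwa [isProbabilityMeasure_iff_real, ← huniv, ← isProbabilityMeasure_iff_real]
  refine ext_of_generate_finite _ Real.borel_eq_generateFrom_Iic_rat Real.isPiSystem_Iic_rat
    (fun s hs => ?_) (by simp)
  obtain ⟨q, rfl⟩ := Set.mem_iUnion.mp hs
  exact (measureReal_eq_measureReal_iff).mp (h q)

lemma HasCondLawOn.ae_condLaw_eq (h : HasCondLawOn μ m V F ν) (hm : m ≤ mΩ) (hV : Measurable V) :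
    ∀ᵐ ω ∂μ, ω ∈ F → condLaw μ m V ω = ν ω := by
  have hset (A : Set ℝ) (hA : MeasurableSet A) :
      ∀ᵐ ω ∂μ, ω ∈ F → (condLaw μ m V ω).real A = (ν ω).real A := by
    filter_upwards [h A hA, condLaw_ae_eq_condExp hm hV hA] with ω hω hω' hF
    rw [hω', hω hF]
  filter_upwards [hset _ .univ, ae_all_iff.mpr fun q : ℚ => hset (Set.Iic q) measurableSet_Iic]
    with ω huniv hIic hF
  exact measure_eq_of_forall_rat_measureReal_Iic_eq (huniv hF) fun q => hIic q hF

lemma HasCondLawOn.setLIntegral_eq (h : HasCondLawOn μ m V F ν) (hm : m ≤ mΩ)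
    (hV : Measurable V) (hF : MeasurableSet[m] F) {f : Ω × ℝ → ℝ≥0∞}
    (hf : Measurable[m.prod inferInstance] f) :
    ∫⁻ ω in F, f (ω, V ω) ∂μ = ∫⁻ ω in F, ∫⁻ y, f (ω, y) ∂ν ω ∂μ := by
  have hF' : MeasurableSet[m.prod inferInstance] (Prod.fst ⁻¹' F : Set (Ω × ℝ)) :=
    @measurable_fst Ω ℝ m _ _ hF
  have hdis := lintegral_lintegral_condLaw (μ := μ) hm hV (hf.indicator hF')
  rw [← lintegral_indicator (hm _ hF), ← lintegral_indicator (hm _ hF)]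
  refine Eq.trans hdis.symm (lintegral_congr_ae ?_)
  filter_upwards [h.ae_condLaw_eq hm hV] with ω hω
  by_cases hωF : ω ∈ F
  · simp [hωF, hω hωF]
  · simp [hωF]

lemma HasCondLawOn.setLIntegral_mul_indicator_Ioc (h : HasCondLawOn μ m V F ν) (hm : m ≤ mΩ)
    (hV : Measurable V) (hF : MeasurableSet[m] F) {a b : Ω → ℝ} {g : Ω → ℝ≥0∞}
    (ha : Measurable[m] a) (hb : Measurable[m] b) (hg : Measurable[m] g) :
    ∫⁻ ω in F, (Set.Ioc (a ω) (b ω)).indicator (fun _ => g ω) (V ω) ∂μ =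
      ∫⁻ ω in F, g ω * ν ω (Set.Ioc (a ω) (b ω)) ∂μ := by
  have hT : MeasurableSet[m.prod inferInstance] {p : Ω × ℝ | p.2 ∈ Set.Ioc (a p.1) (b p.1)} :=
    (measurableSet_lt (ha.comp measurable_fst) measurable_snd).inter
      (measurableSet_le measurable_snd (hb.comp measurable_fst))
  refine Eq.trans (h.setLIntegral_eq hm hV hF ((hg.comp measurable_fst).indicator hT)) ?_
  refine lintegral_congr fun ω => ?_
  rw [← lintegral_indicator_const measurableSet_Ioc]
  rfl

end ConditionalLaw

section ConditionedSteinCoupling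

variable {Ω : Type*} {m mΩ : MeasurableSpace Ω} {μ : Measure Ω}
  {W W' G Gbar Dbar Bbar U : Ω → ℝ} {F₁ F₂ : Set Ω} {ν : Ω → Measure ℝ} {z ε s L : ℝ}

/-- A Stein coupling `(W, W', G)` for which, on `F₁`, the quantities `|G|`, `|W' - W|` and `|W - U|`
have `m`-measurable majorants `Gbar`, `Dbar` and `Bbar`, where on `F₂` the auxiliary variable `U`
has conditional law `ν` given `m`. This is the setting of a single parameter `θ`; in the notation of
the theorem, `U` is `V` normalized by the mean and the standard deviation of `Y`. -/
structure IsConditionedSteinCoupling (m : MeasurableSpace Ω) {mΩ : MeasurableSpace Ω}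
    (μ : Measure Ω) (W W' G Gbar Dbar Bbar U : Ω → ℝ) (F₁ F₂ : Set Ω) (ν : Ω → Measure ℝ) :
    Prop where
  isSteinCoupling : IsSteinCoupling μ W W' G
  measurable_W : Measurable W
  measurable_W' : Measurable W'
  measurable_G : Measurable G
  measurable_U : Measurable U
  integrable_mul_sub : Integrable (fun ω => G ω * (W' ω - W ω)) μ
  le : m ≤ mΩ
  measurableSet_F₁ : MeasurableSet F₁
  measurableSet_F₂ : MeasurableSet[m] F₂
  measurable_Gbar : Measurable[m] Gbar
  measurable_Dbar : Measurable[m] Dbar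
  measurable_Bbar : Measurable[m] Bbar
  abs_G_le : ∀ᵐ ω ∂μ, ω ∈ F₁ → |G ω| ≤ Gbar ω
  abs_sub_le : ∀ᵐ ω ∂μ, ω ∈ F₁ → |W' ω - W ω| ≤ Dbar ω
  abs_sub_U_le : ∀ᵐ ω ∂μ, ω ∈ F₁ → |W ω - U ω| ≤ Bbar ω
  hasCondLawOn : HasCondLawOn μ m U F₂ ν

/-- The error made when a smoothed indicator `ramp z ε` is evaluated along a Stein coupling with
weight `g` and increment `d`: it is supported on the event that `w` is within `d` of the ramp. -/
def rampError (z ε g d w : ℝ) : ℝ :=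
  |g| * (|d| * (Set.Ioc (z - |d|) (z + ε + |d|)).indicator (fun _ => min 1 (|d| / ε)) w)

lemma rampError_le (hε : 0 < ε) (g d w : ℝ) : rampError z ε g d w ≤ ε⁻¹ * (|g| * d ^ 2) := by
  have hind : (Set.Ioc (z - |d|) (z + ε + |d|)).indicator (fun _ => min 1 (|d| / ε)) w ≤ |d| / ε :=
    Set.indicator_apply_le' (fun _ => min_le_right _ _) fun _ => by positivity
  calc rampError z ε g d w ≤ |g| * (|d| * (|d| / ε)) := by unfold rampError; gcongr
    _ = ε⁻¹ * (|g| * d ^ 2) := by rw [← sq_abs d]; ring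

lemma rampError_le_indicator (hε : 0 < ε) {g d w u g' d' b : ℝ} (hg : |g| ≤ g') (hd : |d| ≤ d')
    (hb : |w - u| ≤ b) :
    rampError z ε g d w ≤ (Set.Ioc (z - d' - b) (z + ε + d' + b)).indicator
      (fun _ => g' * (d' * min 1 (d' / ε))) u := by
  have hg' : 0 ≤ g' := (abs_nonneg _).trans hg
  have hd' : 0 ≤ d' := (abs_nonneg _).trans hd
  unfold rampError
  by_cases hw : w ∈ Set.Ioc (z - |d|) (z + ε + |d|)
  · have hu : u ∈ Set.Ioc (z - d' - b) (z + ε + d' + b) := by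
      have := abs_le.mp hb
      constructor <;> linarith [hw.1, hw.2]
    rw [Set.indicator_of_mem hw, Set.indicator_of_mem hu]
    gcongr
  · rw [Set.indicator_of_notMem hw, mul_zero, mul_zero]
    exact Set.indicator_nonneg (fun _ _ => by positivity) _

lemma posExp_rampError_le_mul (hε : 0 < ε) (D : Ω → ℝ) :
    posExp μ (fun ω => rampError z ε (G ω) (D ω) (W ω)) ≤
      ENNReal.ofReal ε⁻¹ * posExp μ (fun ω => |G ω| * D ω ^ 2) := by
  rw [← posExp_const_mul (inv_nonneg.mpr hε.le)]
  exact posExp_mono_ae (.of_forall fun ω => rampError_le hε _ _ _)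

lemma mul_min_one_div_mul_le (hε : 0 < ε) (hs : 0 ≤ s) (hL : 0 ≤ L) {d b : ℝ} (hd : 0 ≤ d)
    (hb : 0 ≤ b) :
    d * min 1 (d / ε) * (s * (ε + 2 * d + 2 * b) + L) ≤
      (3 * s + L / ε) * d ^ 2 + 2 * s / ε * (d ^ 2 * b) :=
  calc d * min 1 (d / ε) * (s * (ε + 2 * d + 2 * b) + L)
      = d * min 1 (d / ε) * (2 * s * d) + d * min 1 (d / ε) * (s * ε + 2 * s * b + L) := by ring
    _ ≤ d * 1 * (2 * s * d) + d * (d / ε) * (s * ε + 2 * s * b + L) := by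
        gcongr
        · exact min_le_left _ _
        · exact min_le_right _ _
    _ = (3 * s + L / ε) * d ^ 2 + 2 * s / ε * (d ^ 2 * b) := by
        field_simp
        ring

lemma ofReal_mul_measure_Ioc_le {ρ : Measure ℝ} (hε : 0 < ε) (hs : 0 ≤ s) (hL : 0 ≤ L)
    (hρ : ∀ u v, u ≤ v → ρ (Set.Ioc u v) ≤ ENNReal.ofReal (s * (v - u) + L))
    {g d b : ℝ} (hg : 0 ≤ g) (hd : 0 ≤ d) (hb : 0 ≤ b) :
    ENNReal.ofReal (g * (d * min 1 (d / ε))) * ρ (Set.Ioc (z - d - b) (z + ε + d + b)) ≤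
      ENNReal.ofReal ((3 * s + L / ε) * (g * d ^ 2) + 2 * s / ε * (g * d ^ 2 * b)) :=
  calc ENNReal.ofReal (g * (d * min 1 (d / ε))) * ρ (Set.Ioc (z - d - b) (z + ε + d + b))
      ≤ ENNReal.ofReal (g * (d * min 1 (d / ε))) * ENNReal.ofReal
          (s * (z + ε + d + b - (z - d - b)) + L) := by
        gcongr
        exact hρ _ _ (by linarith)
    _ = ENNReal.ofReal (g * (d * min 1 (d / ε) * (s * (ε + 2 * d + 2 * b) + L))) := by
        rw [← ENNReal.ofReal_mul (by positivity)]
        ring_nf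
    _ ≤ ENNReal.ofReal (g * ((3 * s + L / ε) * d ^ 2 + 2 * s / ε * (d ^ 2 * b))) := by
        gcongr
        exact mul_min_one_div_mul_le hε hs hL hd hb
    _ = _ := by ring_nf

namespace IsConditionedSteinCoupling

lemma setLIntegral_indicator_Ioc_le [IsFiniteMeasure μ]
    (h : IsConditionedSteinCoupling m μ W W' G Gbar Dbar Bbar U F₁ F₂ ν) (hε : 0 < ε) (hs : 0 ≤ s)
    (hL : 0 ≤ L) {E : Set Ω} (hE : MeasurableSet[m] E) (hEF : E ⊆ F₂)
    (hpos : ∀ ω ∈ E, 0 ≤ Gbar ω ∧ 0 ≤ Dbar ω ∧ 0 ≤ Bbar ω)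
    (hν : ∀ᵐ ω ∂μ, ω ∈ F₂ → ∀ u v, u ≤ v →
      ν ω (Set.Ioc u v) ≤ ENNReal.ofReal (s * (v - u) + L)) :
    ∫⁻ ω in E, (Set.Ioc (z - Dbar ω - Bbar ω) (z + ε + Dbar ω + Bbar ω)).indicator
        (fun _ => ENNReal.ofReal (Gbar ω * (Dbar ω * min 1 (Dbar ω / ε)))) (U ω) ∂μ ≤
      ENNReal.ofReal (3 * s + L / ε) * posExp μ (fun ω => Gbar ω * Dbar ω ^ 2) +
        ENNReal.ofReal (2 * s / ε) *
          posExp (μ.restrict F₂) (fun ω => Gbar ω * Dbar ω ^ 2 * Bbar ω) := by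
  have hG := h.measurable_Gbar
  have hD := h.measurable_Dbar
  have hB := h.measurable_Bbar
  rw [(h.hasCondLawOn.mono hEF).setLIntegral_mul_indicator_Ioc h.le h.measurable_U hE
    (by fun_prop) (by fun_prop) (by fun_prop)]
  calc _ ≤ posExp (μ.restrict E) (fun ω => (3 * s + L / ε) * (Gbar ω * Dbar ω ^ 2) +
          2 * s / ε * (Gbar ω * Dbar ω ^ 2 * Bbar ω)) := by
        refine setLIntegral_mono_ae' (h.le _ hE) ?_
        filter_upwards [hν] with ω hω hωE
        obtain ⟨hG0, hD0, hB0⟩ := hpos ω hωE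
        exact ofReal_mul_measure_Ioc_le hε hs hL (hω (hEF hωE)) hG0 hD0 hB0
    _ ≤ posExp (μ.restrict E) (fun ω => (3 * s + L / ε) * (Gbar ω * Dbar ω ^ 2)) +
          posExp (μ.restrict E) (fun ω => 2 * s / ε * (Gbar ω * Dbar ω ^ 2 * Bbar ω)) :=
        posExp_add_le (Measurable.aemeasurable (.mono (by fun_prop) h.le le_rfl))
    _ ≤ _ := by
        rw [posExp_const_mul (by positivity), posExp_const_mul (by positivity)]
        gcongr
        · exact lintegral_mono' Measure.restrict_le_self le_rfl
        · exact lintegral_mono_set hEF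

lemma posExp_rampError_restrict_inter_le [IsFiniteMeasure μ]
    (h : IsConditionedSteinCoupling m μ W W' G Gbar Dbar Bbar U F₁ F₂ ν) (hε : 0 < ε) (hs : 0 ≤ s)
    (hL : 0 ≤ L) (hν : ∀ᵐ ω ∂μ, ω ∈ F₂ → ∀ u v, u ≤ v →
      ν ω (Set.Ioc u v) ≤ ENNReal.ofReal (s * (v - u) + L)) :
    posExp (μ.restrict (F₁ ∩ F₂)) (fun ω => rampError z ε (G ω) (W' ω - W ω) (W ω)) ≤
      ENNReal.ofReal (3 * s + L / ε) * posExp μ (fun ω => Gbar ω * Dbar ω ^ 2) +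
        ENNReal.ofReal (2 * s / ε) *
          posExp (μ.restrict F₂) (fun ω => Gbar ω * Dbar ω ^ 2 * Bbar ω) := by
  -- `F₁` need not belong to `m`, so it is replaced by this `m`-measurable superset.
  let E : Set Ω := F₂ ∩ ({ω | 0 ≤ Gbar ω} ∩ ({ω | 0 ≤ Dbar ω} ∩ {ω | 0 ≤ Bbar ω}))
  have hE : MeasurableSet[m] E :=
    .inter h.measurableSet_F₂ <| .inter (measurableSet_le measurable_const h.measurable_Gbar) <|
      .inter (measurableSet_le measurable_const h.measurable_Dbar)
        (measurableSet_le measurable_const h.measurable_Bbar)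
  have hsub : (F₁ ∩ F₂ : Set Ω) ≤ᵐ[μ] E := by
    filter_upwards [h.abs_G_le, h.abs_sub_le, h.abs_sub_U_le] with ω hG hD hB hω
    exact ⟨hω.2, (abs_nonneg _).trans (hG hω.1), (abs_nonneg _).trans (hD hω.1),
      (abs_nonneg _).trans (hB hω.1)⟩
  refine le_trans ?_ (h.setLIntegral_indicator_Ioc_le (z := z) hε hs hL hE Set.inter_subset_left
    (fun _ hω => hω.2) hν)
  refine le_trans (setLIntegral_mono_ae' (h.measurableSet_F₁.inter (h.le _ h.measurableSet_F₂)) ?_)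
    (lintegral_mono_set' hsub)
  filter_upwards [h.abs_G_le, h.abs_sub_le, h.abs_sub_U_le] with ω hG hD hB hω
  refine (ENNReal.ofReal_le_ofReal
    (rampError_le_indicator hε (hG hω.1) (hD hω.1) (hB hω.1))).trans_eq ?_
  simp only [Set.indicator_apply, apply_ite ENNReal.ofReal, ENNReal.ofReal_zero]

lemma posExp_rampError_le [IsFiniteMeasure μ]
    (h : IsConditionedSteinCoupling m μ W W' G Gbar Dbar Bbar U F₁ F₂ ν) (hε : 0 < ε) (hs : 0 ≤ s)
    (hL : 0 ≤ L) (hν : ∀ᵐ ω ∂μ, ω ∈ F₂ → ∀ u v, u ≤ v →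
      ν ω (Set.Ioc u v) ≤ ENNReal.ofReal (s * (v - u) + L)) :
    posExp μ (fun ω => rampError z ε (G ω) (W' ω - W ω) (W ω)) ≤
      ENNReal.ofReal ε⁻¹ * posExp (μ.restrict F₁ᶜ) (fun ω => |G ω| * (W' ω - W ω) ^ 2) +
      ENNReal.ofReal ε⁻¹ * posExp (μ.restrict F₂ᶜ) (fun ω => |G ω| * (W' ω - W ω) ^ 2) +
      (ENNReal.ofReal (3 * s + L / ε) * posExp μ (fun ω => Gbar ω * Dbar ω ^ 2) +
        ENNReal.ofReal (2 * s / ε) *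
          posExp (μ.restrict F₂) (fun ω => Gbar ω * Dbar ω ^ 2 * Bbar ω)) := by
  have hcover : F₁ᶜ ∪ F₂ᶜ ∪ F₁ ∩ F₂ = Set.univ := by
    rw [← Set.compl_inter, Set.compl_union_self]
  conv_lhs => rw [posExp, ← setLIntegral_univ, ← hcover]
  refine (lintegral_union_le _ _ _).trans (add_le_add ?_
    (h.posExp_rampError_restrict_inter_le hε hs hL hν))
  exact (lintegral_union_le _ _ _).trans
    (add_le_add (posExp_rampError_le_mul hε _) (posExp_rampError_le_mul hε _))

end IsConditionedSteinCoupling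

end ConditionedSteinCoupling

section KolmogorovBound

variable {Ω : Type*} {m mΩ : MeasurableSpace Ω} {μ : Measure Ω}
  {W W' G Gbar Dbar Bbar U : Ω → ℝ} {F₁ F₂ : Set Ω} {ν : Ω → Measure ℝ} {z ε s L A r c Δ : ℝ}

lemma integral_ramp_mem_Icc (ρ : Measure ℝ) [IsProbabilityMeasure ρ] (z ε : ℝ) :
    ∫ x, ramp z ε x ∂ρ ∈ Set.Icc 0 1 := by
  refine ⟨integral_nonneg fun x => (ramp_mem_Icc z ε x).1, ?_⟩
  calc ∫ x, ramp z ε x ∂ρ ≤ ∫ _, 1 ∂ρ :=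
        integral_mono (integrable_ramp ρ z ε) (integrable_const _) fun x => (ramp_mem_Icc z ε x).2
    _ = 1 := by simp

/-- The moment conditions on a conditioned Stein coupling, all with the same constant `A`: the first
two moments and the one of `Gbar * Dbar ^ 2` are of order `1 / r`, while the contributions of the
exceptional events and of `Bbar` are of order `1 / r ^ 2`. -/
structure HasMomentRate {mΩ : MeasurableSpace Ω} (μ : Measure Ω)
    (W W' G Gbar Dbar Bbar : Ω → ℝ) (F₁ F₂ : Set Ω) (A r : ℝ) : Prop where
  condExp : posExp μ (fun ω => |(μ[fun ω' => 1 - G ω' * (W' ω' - W ω') |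
    MeasurableSpace.comap W inferInstance]) ω|) ≤ ENNReal.ofReal (A / r)
  mul_sub_sq : posExp μ (fun ω => (1 + |W ω|) * |G ω| * (W' ω - W ω) ^ 2) ≤ ENNReal.ofReal (A / r)
  compl_F₁ : posExp (μ.restrict F₁ᶜ) (fun ω => |G ω| * (W' ω - W ω) ^ 2) ≤
    ENNReal.ofReal (A / r ^ 2)
  compl_F₂ : posExp (μ.restrict F₂ᶜ) (fun ω => |G ω| * (W' ω - W ω) ^ 2) ≤
    ENNReal.ofReal (A / r ^ 2)
  Gbar_Dbar_sq : posExp μ (fun ω => Gbar ω * Dbar ω ^ 2) ≤ ENNReal.ofReal (A / r)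
  Gbar_Dbar_sq_Bbar : posExp (μ.restrict F₂) (fun ω => Gbar ω * Dbar ω ^ 2 * Bbar ω) ≤
    ENNReal.ofReal (A / r ^ 2)

lemma IsSteinCoupling.ofReal_abs_integral_ramp_sub_le [IsProbabilityMeasure μ]
    (h : IsSteinCoupling μ W W' G) (hW : Measurable W) (hW' : Measurable W') (hG : Measurable G)
    (hGD : Integrable (fun ω => G ω * (W' ω - W ω)) μ) (hε : 0 < ε) :
    ENNReal.ofReal |∫ ω, ramp z ε (W ω) ∂μ - ∫ x, ramp z ε x ∂(gaussianReal 0 1)| ≤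
      ENNReal.ofReal 2 * posExp μ (fun ω =>
        |(μ[fun ω' => 1 - G ω' * (W' ω' - W ω') | MeasurableSpace.comap W inferInstance]) ω|) +
      (ENNReal.ofReal 3 * posExp μ (fun ω => (1 + |W ω|) * |G ω| * (W' ω - W ω) ^ 2) +
      posExp μ (fun ω => rampError z ε (G ω) (W' ω - W ω) (W ω))) := by
  have hM (x : ℝ) : |ramp z ε x - ∫ y, ramp z ε y ∂(gaussianReal 0 1)| ≤ 1 :=
    abs_sub_le_of_nonneg_of_le (ramp_mem_Icc z ε x).1 (ramp_mem_Icc z ε x).2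
      (integral_ramp_mem_Icc _ z ε).1 (integral_ramp_mem_Icc _ z ε).2
  simpa only [mul_one, rampError] using
    h.ofReal_abs_integral_sub_le hW hW' hG hGD (continuous_ramp z ε) hM fun ω t ht =>
      abs_ramp_add_sub_ramp_le hε ht

lemma HasMomentRate.abs_integral_ramp_sub_le [IsProbabilityMeasure μ]
    (hA : HasMomentRate μ W W' G Gbar Dbar Bbar F₁ F₂ A r)
    (h : IsConditionedSteinCoupling m μ W W' G Gbar Dbar Bbar U F₁ F₂ ν) (hA0 : 0 ≤ A)
    (hr : 0 < r) (hε : 0 < ε) (hs : 0 ≤ s) (hL : 0 ≤ L)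
    (hν : ∀ᵐ ω ∂μ, ω ∈ F₂ → ∀ u v, u ≤ v →
      ν ω (Set.Ioc u v) ≤ ENNReal.ofReal (s * (v - u) + L)) :
    |∫ ω, ramp z ε (W ω) ∂μ - ∫ x, ramp z ε x ∂(gaussianReal 0 1)| ≤
      (5 + 3 * s + L / ε) * (A / r) + 2 * (1 + s) / ε * (A / r ^ 2) := by
  rw [← ENNReal.ofReal_le_ofReal_iff (by positivity)]
  refine (h.isSteinCoupling.ofReal_abs_integral_ramp_sub_le h.measurable_W h.measurable_W'
    h.measurable_G h.integrable_mul_sub hε).trans ?_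
  grw [h.posExp_rampError_le hε hs hL hν, hA.condExp, hA.mul_sub_sq, hA.compl_F₁, hA.compl_F₂,
    hA.Gbar_Dbar_sq, hA.Gbar_Dbar_sq_Bbar]
  simp (disch := positivity) only [← ENNReal.ofReal_mul, ← ENNReal.ofReal_add]
  refine ENNReal.ofReal_le_ofReal (le_of_eq ?_)
  ring

lemma HasMomentRate.kolmogorovDist_le [IsProbabilityMeasure μ]
    (hA : HasMomentRate μ W W' G Gbar Dbar Bbar F₁ F₂ A r)
    (h : IsConditionedSteinCoupling m μ W W' G Gbar Dbar Bbar U F₁ F₂ ν) (hA0 : 0 < A)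
    (hr : 0 < r) (hc : 0 < c) (hs : 0 ≤ s) (hΔ : 0 ≤ Δ)
    (hν : ∀ᵐ ω ∂μ, ω ∈ F₂ → ∀ u v, u ≤ v →
      ν ω (Set.Ioc u v) ≤ ENNReal.ofReal (s * (v - u) + 2 * Δ)) :
    kolmogorovDist (μ.map W) (gaussianReal 0 1) ≤
      ((5 + 3 * s) * A + (1 + s) / (2 * c) + 4 * c * A) / r + Δ / (2 * c) := by
  -- The smoothing scale `ε` is chosen such that the coefficient of `Δ` becomes `1 / (2 * c)`.
  obtain ⟨ε, hε_def⟩ : ∃ ε, ε = 4 * c * A / r := ⟨_, rfl⟩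
  have hε : 0 < ε := hε_def ▸ by positivity
  have hramp (z : ℝ) :=
    hA.abs_integral_ramp_sub_le (z := z) h hA0.le hr hε hs (mul_nonneg zero_le_two hΔ) hν
  simp only [← integral_map h.measurable_W.aemeasurable
    (continuous_ramp _ _).aestronglyMeasurable] at hramp
  have hγ (z : ℝ) : (gaussianReal 0 1).real (Set.Ioc z (z + ε)) ≤ ε := by
    simpa only [add_sub_cancel_left] using
      gaussianReal_real_Ioc_le (le_add_of_nonneg_right hε.le : z ≤ z + ε)
  refine (kolmogorovDist_le_of_integral_ramp hε hramp hγ).trans_eq ?_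
  rw [hε_def]
  field_simp
  ring

end KolmogorovBound

section SelfImprovement

variable {Θ : Type*} {r δ : Θ → ℝ} {B c : ℝ}

lemma le_div_add_pow_of_self_improving (hr : ∀ θ, 0 < r θ) (hδ : ∀ θ, δ θ ≤ 1) (hB : 0 ≤ B)
    (hc : 1 ≤ c) (hstep : ∀ θ Δ, 0 ≤ Δ → (∀ ψ, r θ ≤ c * r ψ → δ ψ ≤ Δ) →
      δ θ ≤ B / r θ + Δ / (2 * c)) (k : ℕ) (θ : Θ) : δ θ ≤ 2 * B / r θ + (1 / 2) ^ k := by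
  induction k generalizing θ with
  | zero =>
    have := div_nonneg (mul_nonneg zero_le_two hB) (hr θ).le
    rw [pow_zero]
    linarith [hδ θ]
  | succ k ih =>
    have hrθ := hr θ
    have hΔ (ψ : Θ) (hψ : r θ ≤ c * r ψ) : δ ψ ≤ c * (2 * B / r θ) + (1 / 2) ^ k := by
      have hrψ := hr ψ
      refine (ih ψ).trans (add_le_add_left ?_ _)
      rw [← mul_div_assoc, div_le_div_iff₀ hrψ hrθ]
      calc 2 * B * r θ ≤ 2 * B * (c * r ψ) := by gcongr
        _ = c * (2 * B) * r ψ := by ring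
    calc δ θ ≤ B / r θ + (c * (2 * B / r θ) + (1 / 2) ^ k) / (2 * c) :=
          hstep θ _ (by positivity) hΔ
      _ = 2 * B / r θ + (1 / 2) ^ k / 2 / c := by
          field_simp
          ring
      _ ≤ 2 * B / r θ + (1 / 2) ^ k / 2 := by
          exact add_le_add_right (div_le_self (by positivity) hc) _
      _ = 2 * B / r θ + (1 / 2) ^ (k + 1) := by ring

lemma le_div_of_self_improving (hr : ∀ θ, 0 < r θ) (hδ : ∀ θ, δ θ ≤ 1) (hB : 0 ≤ B)
    (hc : 1 ≤ c) (hstep : ∀ θ Δ, 0 ≤ Δ → (∀ ψ, r θ ≤ c * r ψ → δ ψ ≤ Δ) →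
      δ θ ≤ B / r θ + Δ / (2 * c)) (θ : Θ) : δ θ ≤ 2 * B / r θ := by
  have hlim : Filter.Tendsto (fun k : ℕ => 2 * B / r θ + (1 / 2) ^ k) Filter.atTop
      (nhds (2 * B / r θ + 0)) :=
    tendsto_const_nhds.add
      (tendsto_pow_atTop_nhds_zero_of_lt_one one_half_pos.le one_half_lt_one)
  rw [← add_zero (2 * B / r θ)]
  exact ge_of_tendsto' hlim fun k => le_div_add_pow_of_self_improving hr hδ hB hc hstep k θ

lemma le_div_of_self_improving_of_lt {r₀ : ℝ} (hr : ∀ θ, 0 < r θ) (hδ : ∀ θ, δ θ ≤ 1) (hB : 0 ≤ B)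
    (hc : 1 ≤ c) (hr₀ : 0 ≤ r₀) (hstep : ∀ θ Δ, r₀ < r θ → 0 ≤ Δ →
      (∀ ψ, r θ ≤ c * r ψ → δ ψ ≤ Δ) → δ θ ≤ B / r θ + Δ / (2 * c)) (θ : Θ) :
    δ θ ≤ 2 * (B + r₀) / r θ := by
  refine le_div_of_self_improving hr hδ (add_nonneg hB hr₀) hc (fun θ Δ hΔ hψ => ?_) θ
  have hrθ := hr θ
  obtain hsmall | hlarge := le_or_gt (r θ) r₀
  · have hone : 1 ≤ (B + r₀) / r θ := (one_le_div hrθ).mpr (by linarith)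
    exact (hδ θ).trans (hone.trans (le_add_of_nonneg_right (by positivity)))
  · refine (hstep θ Δ hlarge hΔ hψ).trans ?_
    gcongr
    exact le_add_of_nonneg_right hr₀

end SelfImprovement

section UniformBounds

variable {Θ Ω : Type*} [MeasurableSpace Ω] {S : Set Θ}

lemma eventually_forall_le_of_iSup_mul_lt_top {c : Θ → ℝ} (hc : ∀ θ ∈ S, 0 < c θ)
    {X : Θ → ℝ≥0∞} (h : ⨆ θ ∈ S, ENNReal.ofReal (c θ) * X θ < ∞) :
    ∀ᶠ C : ℝ in Filter.atTop, ∀ θ ∈ S, X θ ≤ ENNReal.ofReal (C / c θ) := by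
  filter_upwards [Filter.eventually_ge_atTop (⨆ θ ∈ S, ENNReal.ofReal (c θ) * X θ).toReal]
    with C hC θ hθ
  rw [ENNReal.ofReal_div_of_pos (hc θ hθ),
    ENNReal.le_div_iff_mul_le (.inl (by simpa using hc θ hθ)) (.inl ENNReal.ofReal_ne_top),
    mul_comm (X θ)]
  exact (le_iSup₂ (f := fun θ (_ : θ ∈ S) => ENNReal.ofReal (c θ) * X θ) θ hθ).trans
    ((ENNReal.le_ofReal_iff_toReal_le h.ne (ENNReal.toReal_nonneg.trans hC)).mpr hC)

lemma eventually_forall_ae_le_of_iSup_essSupOn_lt_top {μ : Θ → Measure Ω} {T : Θ → Set Ω}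
    {X : Θ → Ω → ℝ} (h : ⨆ θ ∈ S, essSupOn (μ θ) (T θ) (X θ) < ∞) :
    ∀ᶠ C : ℝ in Filter.atTop, ∀ θ ∈ S, ∀ᵐ ω ∂(μ θ), ω ∈ T θ → X θ ω ≤ C := by
  filter_upwards [Filter.eventually_ge_atTop (⨆ θ ∈ S, essSupOn (μ θ) (T θ) (X θ)).toReal]
    with C hC θ hθ
  refine ae_imp_of_ae_restrict ?_
  filter_upwards [ENNReal.ae_le_essSup (μ := (μ θ).restrict (T θ))
    fun ω => ENNReal.ofReal (X θ ω)] with ω hω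
  refine ((ENNReal.ofReal_le_iff_le_toReal h.ne).mp (hω.trans ?_)).trans hC
  exact le_iSup₂ (f := fun θ (_ : θ ∈ S) => essSupOn (μ θ) (T θ) (X θ)) θ hθ

lemma eventually_forall_hasMomentRate {μ : Θ → Measure Ω} {W W' G Gbar Dbar Bbar : Θ → Ω → ℝ}
    {F₁ F₂ : Θ → Set Ω} {r : Θ → ℝ} (hr : ∀ θ ∈ S, 0 < r θ)
    (hcondExp : ⨆ θ ∈ S, ENNReal.ofReal (r θ) *
      posExp (μ θ) (fun ω => |((μ θ)[fun ω' => 1 - G θ ω' * (W' θ ω' - W θ ω') |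
        MeasurableSpace.comap (W θ) inferInstance]) ω|) < ∞)
    (hmul_sub_sq : ⨆ θ ∈ S, ENNReal.ofReal (r θ) *
      posExp (μ θ) (fun ω => (1 + |W θ ω|) * |G θ ω| * (W' θ ω - W θ ω) ^ 2) < ∞)
    (hcompl_F₁ : ⨆ θ ∈ S, ENNReal.ofReal (r θ ^ 2) *
      posExp ((μ θ).restrict (F₁ θ)ᶜ) (fun ω => |G θ ω| * (W' θ ω - W θ ω) ^ 2) < ∞)
    (hcompl_F₂ : ⨆ θ ∈ S, ENNReal.ofReal (r θ ^ 2) *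
      posExp ((μ θ).restrict (F₂ θ)ᶜ) (fun ω => |G θ ω| * (W' θ ω - W θ ω) ^ 2) < ∞)
    (hGbar_Dbar_sq : ⨆ θ ∈ S, ENNReal.ofReal (r θ) *
      posExp (μ θ) (fun ω => Gbar θ ω * Dbar θ ω ^ 2) < ∞)
    (hGbar_Dbar_sq_Bbar : ⨆ θ ∈ S, ENNReal.ofReal (r θ ^ 2) *
      posExp ((μ θ).restrict (F₂ θ)) (fun ω => Gbar θ ω * Dbar θ ω ^ 2 * Bbar θ ω) < ∞) :
    ∀ᶠ C in Filter.atTop, ∀ θ ∈ S, HasMomentRate (μ θ) (W θ) (W' θ) (G θ) (Gbar θ) (Dbar θ)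
      (Bbar θ) (F₁ θ) (F₂ θ) C (r θ) := by
  have hr2 (θ : Θ) (hθ : θ ∈ S) : 0 < r θ ^ 2 := pow_pos (hr θ hθ) 2
  filter_upwards [eventually_forall_le_of_iSup_mul_lt_top hr hcondExp,
    eventually_forall_le_of_iSup_mul_lt_top hr hmul_sub_sq,
    eventually_forall_le_of_iSup_mul_lt_top hr2 hcompl_F₁,
    eventually_forall_le_of_iSup_mul_lt_top hr2 hcompl_F₂,
    eventually_forall_le_of_iSup_mul_lt_top hr hGbar_Dbar_sq,
    eventually_forall_le_of_iSup_mul_lt_top hr2 hGbar_Dbar_sq_Bbar]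
    with C h₁ h₂ h₃ h₄ h₅ h₆ θ hθ
  exact ⟨h₁ θ hθ, h₂ θ hθ, h₃ θ hθ, h₄ θ hθ, h₅ θ hθ, h₆ θ hθ⟩

end UniformBounds

section Standardize

variable {Θ Ω : Type*} [MeasurableSpace Θ] [MeasurableSpace Ω] {P : Kernel Θ Ω}
  {Y : Θ → Ω → ℝ} {θ ψ : Θ} {s Δ : ℝ}

lemma standardize_of_variance_pos (h : 0 < Var[Y θ; P θ]) (ω : Ω) :
    standardize P Y θ ω = (Y θ ω - ∫ ω', Y θ ω' ∂(P θ)) / √Var[Y θ; P θ] :=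
  if_pos h

lemma measurable_standardize (hY : Measurable (Y θ)) : Measurable (standardize P Y θ) := by
  unfold standardize
  split_ifs <;> fun_prop

lemma aemeasurable_standardize (hY : AEMeasurable (Y θ) (P θ)) :
    AEMeasurable (standardize P Y θ) (P θ) := by
  unfold standardize
  split_ifs <;> fun_prop

/-- The Kolmogorov distance between the law of the standardization of `Y θ` under `P θ` and the
standard normal law: the quantity to be bounded. -/
def normalDist (P : Kernel Θ Ω) (Y : Θ → Ω → ℝ) (θ : Θ) : ℝ :=
  kolmogorovDist ((P θ).map (standardize P Y θ)) (gaussianReal 0 1)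

lemma normalDist_eq (hY : AEMeasurable (Y θ) (P θ)) :
    normalDist P Y θ = ⨆ z, |(P θ).real {ω | standardize P Y θ ω ≤ z} -
      (gaussianReal 0 1).real (Set.Iic z)| := by
  simp only [normalDist, kolmogorovDist,
    map_measureReal_apply_of_aemeasurable (aemeasurable_standardize hY) measurableSet_Iic]
  rfl

lemma normalDist_le_one [IsMarkovKernel P] (hY : AEMeasurable (Y θ) (P θ)) :
    normalDist P Y θ ≤ 1 := by
  have := Measure.isProbabilityMeasure_map (aemeasurable_standardize hY)
  exact kolmogorovDist_le_one _ _

lemma map_map_sub_div_eq (hY : Measurable (Y ψ)) (hψ : 0 < Var[Y ψ; P ψ]) (b σ : ℝ) :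
    ((P ψ).map (Y ψ)).map (fun y => (y - b) / σ) = ((P ψ).map (standardize P Y ψ)).map
      (fun x => √Var[Y ψ; P ψ] / σ * x + (∫ ω, Y ψ ω ∂(P ψ) - b) / σ) := by
  have hσψ : √Var[Y ψ; P ψ] ≠ 0 := (Real.sqrt_pos.mpr hψ).ne'
  rw [Measure.map_map (by fun_prop) hY, Measure.map_map (by fun_prop) (measurable_standardize hY)]
  congr 1 with ω
  simp only [Function.comp_apply, standardize_of_variance_pos hψ]
  field_simp
  ring

lemma measure_map_map_sub_div_Ioc_le [IsMarkovKernel P] (hY : Measurable (Y ψ))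
    (hψ : 0 < Var[Y ψ; P ψ]) (hΔ : normalDist P Y ψ ≤ Δ) {σ : ℝ} (hσ : 0 < σ)
    (hs : σ / √Var[Y ψ; P ψ] ≤ s) (b : ℝ) {u v : ℝ} (huv : u ≤ v) :
    ((P ψ).map (Y ψ)).map (fun y => (y - b) / σ) (Set.Ioc u v) ≤
      ENNReal.ofReal (s * (v - u) + 2 * Δ) := by
  have hσψ : 0 < √Var[Y ψ; P ψ] := Real.sqrt_pos.mpr hψ
  rw [map_map_sub_div_eq hY hψ, ← ofReal_measureReal]
  refine ENNReal.ofReal_le_ofReal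
    ((measureReal_map_affine_Ioc_le (div_pos hσψ hσ) _ huv).trans (add_le_add ?_ ?_))
  · rw [div_div_eq_mul_div, mul_div_assoc, mul_comm]
    exact mul_le_mul_of_nonneg_right hs (sub_nonneg.mpr huv)
  · exact mul_le_mul_of_nonneg_left hΔ zero_le_two

end Standardize

section StandardizedCoupling

variable {Θ Ω : Type*} [MeasurableSpace Θ] {m : MeasurableSpace Ω} [mΩ : MeasurableSpace Ω]
  {P : Kernel Θ Ω} {Y : Θ → Ω → ℝ} {θ : Θ}

lemma ae_measure_map_map_sub_div_Ioc_le [IsMarkovKernel P] {Ψ : Ω → Θ} {F : Set Ω} {S : Set Θ}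
    {r : Θ → ℝ} {c Δ : ℝ} (hY : ∀ ψ ∈ S, Measurable (Y ψ)) (hVar : ∀ ψ ∈ S, 0 < Var[Y ψ; P ψ])
    (hr : ∀ ψ, 0 < r ψ) (hθ : θ ∈ S) (hS : ∀ ψ, r θ ≤ c * r ψ → ψ ∈ S)
    (hΔ : ∀ ψ, r θ ≤ c * r ψ → normalDist P Y ψ ≤ Δ)
    (hσ_ratio : ∀ᵐ ω ∂(P θ), ω ∈ F ∩ {ω | Ψ ω ∈ S} →
      Var[Y θ; P θ] / Var[Y (Ψ ω); P (Ψ ω)] ≤ c)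
    (hr_ratio : ∀ᵐ ω ∂(P θ), ω ∈ F → r θ / r (Ψ ω) ≤ c) (b : ℝ) :
    ∀ᵐ ω ∂(P θ), ω ∈ F → ∀ u v, u ≤ v →
      ((P (Ψ ω)).map (Y (Ψ ω))).map (fun y => (y - b) / √Var[Y θ; P θ]) (Set.Ioc u v) ≤
        ENNReal.ofReal (√c * (v - u) + 2 * Δ) := by
  filter_upwards [hσ_ratio, hr_ratio] with ω hσω hrω hω u v huv
  have hrΨ : r θ ≤ c * r (Ψ ω) := (div_le_iff₀ (hr _)).mp (hrω hω)
  have hΨ : Ψ ω ∈ S := hS _ hrΨ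
  refine measure_map_map_sub_div_Ioc_le (hY _ hΨ) (hVar _ hΨ) (hΔ _ hrΨ)
    (Real.sqrt_pos.mpr (hVar θ hθ)) ?_ b huv
  rw [← Real.sqrt_div (hVar θ hθ).le]
  exact Real.sqrt_le_sqrt (hσω ⟨hω, hΨ⟩)

lemma isConditionedSteinCoupling_standardize {W' G Gbar Dbar Bbar V : Ω → ℝ} {F₁ F₂ : Set Ω}
    {ν : Ω → Measure ℝ} (hVar : 0 < Var[Y θ; P θ])
    (hY : Measurable (Y θ)) (hW' : Measurable W') (hG : Measurable G) (hV : Measurable V)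
    (hStein : IsSteinCoupling (P θ) (standardize P Y θ) W' G)
    (hGD : Integrable (fun ω => G ω * (W' ω - standardize P Y θ ω)) (P θ))
    (hm : m ≤ mΩ) (hF₁ : MeasurableSet F₁) (hF₂ : MeasurableSet[m] F₂)
    (hGbar : Measurable[m] Gbar) (hDbar : Measurable[m] Dbar) (hBbar : Measurable[m] Bbar)
    (hGbar_le : ∀ᵐ ω ∂(P θ), ω ∈ F₁ → |G ω| ≤ Gbar ω)
    (hDbar_le : ∀ᵐ ω ∂(P θ), ω ∈ F₁ → |W' ω - standardize P Y θ ω| ≤ Dbar ω)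
    (hBbar_le : ∀ᵐ ω ∂(P θ), ω ∈ F₁ → (√Var[Y θ; P θ])⁻¹ * |Y θ ω - V ω| ≤ Bbar ω)
    (hV_law : HasCondLawOn (P θ) m V F₂ ν) :
    IsConditionedSteinCoupling m (P θ) (standardize P Y θ) W' G Gbar Dbar Bbar
      (fun ω => (V ω - ∫ ω', Y θ ω' ∂(P θ)) / √Var[Y θ; P θ]) F₁ F₂
      (fun ω => (ν ω).map fun y => (y - ∫ ω', Y θ ω' ∂(P θ)) / √Var[Y θ; P θ]) where
  isSteinCoupling := hStein
  measurable_W := measurable_standardize hY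
  measurable_W' := hW'
  measurable_G := hG
  measurable_U := (hV.sub_const _).div_const _
  integrable_mul_sub := hGD
  le := hm
  measurableSet_F₁ := hF₁
  measurableSet_F₂ := hF₂
  measurable_Gbar := hGbar
  measurable_Dbar := hDbar
  measurable_Bbar := hBbar
  abs_G_le := hGbar_le
  abs_sub_le := hDbar_le
  abs_sub_U_le := by
    filter_upwards [hBbar_le] with ω hω hω₁
    rw [standardize_of_variance_pos hVar, ← sub_div, sub_sub_sub_cancel_right, abs_div,
      abs_of_nonneg (Real.sqrt_nonneg _), div_eq_inv_mul]
    exact hω hω₁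
  hasCondLawOn := hV_law.map ((measurable_id.sub_const _).div_const _)

end StandardizedCoupling

theorem theorem1_general {Θ Ω : Type*} [MeasurableSpace Θ] [mΩ : MeasurableSpace Ω]
    (P : Kernel Θ Ω) [IsMarkovKernel P]
    (Y W' G Gbar Dbar V Bbar : Θ → Ω → ℝ) (Ψ : Θ → Ω → Θ) (r : Θ → ℝ) (rbar : ℝ)
    (hY : ∀ θ ∈ goodSet r rbar, Measurable (Y θ)) (hW' : ∀ θ ∈ goodSet r rbar, Measurable (W' θ))
    (hG : ∀ θ ∈ goodSet r rbar, Measurable (G θ)) (hV : ∀ θ ∈ goodSet r rbar, Measurable (V θ))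
    (hY2 : ∀ θ, MemLp (Y θ) 2 (P θ))
    (hr_pos : ∀ θ, 0 < r θ) (hrbar : 0 < rbar)
    (hVar : ∀ θ ∈ goodSet r rbar, 0 < Var[Y θ; P θ])
    (hStein : ∀ θ ∈ goodSet r rbar,
      IsSteinCoupling (P θ) (standardize P Y θ) (W' θ) (G θ))
    (hGD_int : ∀ θ ∈ goodSet r rbar,
      Integrable (fun ω => G θ ω * couplingDiff P Y W' θ ω) (P θ))
    (hGD : ⨆ θ ∈ goodSet r rbar, ENNReal.ofReal (r θ) *
      posExp (P θ) (fun ω => |((P θ)[fun ω' => 1 - G θ ω' * couplingDiff P Y W' θ ω' |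
        MeasurableSpace.comap (standardize P Y θ) inferInstance]) ω|) < ∞)
    (hWGD : ⨆ θ ∈ goodSet r rbar, ENNReal.ofReal (r θ) *
      posExp (P θ) (fun ω =>
        (1 + |standardize P Y θ ω|) * |G θ ω| * couplingDiff P Y W' θ ω ^ 2) < ∞)
    (ℱ : Θ → MeasurableSpace Ω) (F₁ : Θ → Set Ω)
    (hℱ : ∀ θ ∈ goodSet r rbar, ℱ θ ≤ mΩ)
    (hF₁ : ∀ θ ∈ goodSet r rbar, MeasurableSet (F₁ θ))
    (hGbar_meas : ∀ θ ∈ goodSet r rbar, Measurable[ℱ θ] (Gbar θ))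
    (hDbar_meas : ∀ θ ∈ goodSet r rbar, Measurable[ℱ θ] (Dbar θ))
    (hGbar_le : ∀ θ ∈ goodSet r rbar, ∀ᵐ ω ∂(P θ), ω ∈ F₁ θ → |G θ ω| ≤ Gbar θ ω)
    (hDbar_le : ∀ θ ∈ goodSet r rbar, ∀ᵐ ω ∂(P θ), ω ∈ F₁ θ →
      |couplingDiff P Y W' θ ω| ≤ Dbar θ ω)
    (hF₁_mom : ⨆ θ ∈ goodSet r rbar, ENNReal.ofReal (r θ ^ 2) *
      posExp ((P θ).restrict (F₁ θ)ᶜ)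
        (fun ω => |G θ ω| * couplingDiff P Y W' θ ω ^ 2) < ∞)
    (hbar_mom : ⨆ θ ∈ goodSet r rbar, ENNReal.ofReal (r θ) *
      posExp (P θ) (fun ω => Gbar θ ω * Dbar θ ω ^ 2) < ∞)
    (F₂ : Θ → Set Ω)
    (hF₂ : ∀ θ ∈ goodSet r rbar, MeasurableSet[ℱ θ] (F₂ θ))
    (hV_law : ∀ θ ∈ goodSet r rbar, HasCondLawOn (P θ) (ℱ θ) (V θ) (F₂ θ)
      (fun ω => (P (Ψ θ ω)).map (Y (Ψ θ ω))))
    (hF₂_mom : ⨆ θ ∈ goodSet r rbar, ENNReal.ofReal (r θ ^ 2) *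
      posExp ((P θ).restrict (F₂ θ)ᶜ)
        (fun ω => |G θ ω| * couplingDiff P Y W' θ ω ^ 2) < ∞)
    (hBbar_meas : ∀ θ ∈ goodSet r rbar, Measurable[ℱ θ] (Bbar θ))
    (hBbar_le : ∀ θ ∈ goodSet r rbar, ∀ᵐ ω ∂(P θ), ω ∈ F₁ θ →
      (√Var[Y θ; P θ])⁻¹ * |Y θ ω - V θ ω| ≤ Bbar θ ω)
    (hBbar_mom : ⨆ θ ∈ goodSet r rbar, ENNReal.ofReal (r θ ^ 2) *
      posExp ((P θ).restrict (F₂ θ))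
        (fun ω => Gbar θ ω * Dbar θ ω ^ 2 * Bbar θ ω) < ∞)
    (hσ_ratio : ⨆ θ ∈ goodSet r rbar,
      essSupOn (P θ) (F₂ θ ∩ {ω | Ψ θ ω ∈ goodSet r rbar})
        (fun ω => Var[Y θ; P θ] / Var[Y (Ψ θ ω); P (Ψ θ ω)]) < ∞)
    (hr_ratio : ⨆ θ ∈ goodSet r rbar,
      essSupOn (P θ) (F₂ θ) (fun ω => r θ / r (Ψ θ ω)) < ∞) :
    ∃ C : ℝ, ∀ θ : Θ,
      ⨆ z : ℝ, |(P θ).real {ω | standardize P Y θ ω ≤ z}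
        - (gaussianReal 0 1).real (Set.Iic z)| ≤ C / r θ := by
  obtain ⟨C, hrate, hσC, hrC, hC1⟩ := ((eventually_forall_hasMomentRate (fun θ _ => hr_pos θ)
    hGD hWGD hF₁_mom hF₂_mom hbar_mom hBbar_mom).and <|
    (eventually_forall_ae_le_of_iSup_essSupOn_lt_top hσ_ratio).and <|
    (eventually_forall_ae_le_of_iSup_essSupOn_lt_top hr_ratio).and <|
    Filter.eventually_ge_atTop 1).exists
  have hC0 : 0 < C := one_pos.trans_le hC1
  have hYm (θ : Θ) : AEMeasurable (Y θ) (P θ) := (hY2 θ).aestronglyMeasurable.aemeasurable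
  let K := (5 + 3 * √C) * C + (1 + √C) / (2 * C) + 4 * C * C
  refine ⟨2 * (K + C * rbar), fun θ => normalDist_eq (hYm θ) ▸ le_div_of_self_improving_of_lt hr_pos
    (fun θ => normalDist_le_one (hYm θ)) (by positivity) hC1 (by positivity)
    (fun θ Δ hlarge hΔ0 hΔ => ?_) θ⟩
  have hgood (ψ : Θ) (hψ : r θ ≤ C * r ψ) : ψ ∈ goodSet r rbar :=
    lt_of_mul_lt_mul_left (hlarge.trans_le hψ) hC0.le
  have hθ := hgood θ (le_mul_of_one_le_left (hr_pos θ).le hC1)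
  have hcoupling := isConditionedSteinCoupling_standardize (hVar θ hθ) (hY θ hθ) (hW' θ hθ)
    (hG θ hθ) (hV θ hθ) (hStein θ hθ) (hGD_int θ hθ) (hℱ θ hθ) (hF₁ θ hθ) (hF₂ θ hθ)
    (hGbar_meas θ hθ) (hDbar_meas θ hθ) (hBbar_meas θ hθ) (hGbar_le θ hθ) (hDbar_le θ hθ)
    (hBbar_le θ hθ) (hV_law θ hθ)
  have hlaw := ae_measure_map_map_sub_div_Ioc_le hY hVar hr_pos hθ hgood hΔ (hσC θ hθ)
    (hrC θ hθ) (∫ ω, Y θ ω ∂(P θ))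
  exact (hrate θ hθ).kolmogorovDist_le hcoupling hC0 (hr_pos θ) hC0 (Real.sqrt_nonneg C) hΔ0 hlaw

end

theorem theorem1 {Θ Ω : Type*} [MeasurableSpace Θ] [mΩ : MeasurableSpace Ω]
    -- general framework: a transition kernel and jointly measurable random variables
    (P : Kernel Θ Ω) [IsMarkovKernel P]
    (Y W' G Gbar Dbar V Bbar : Θ → Ω → ℝ) (Ψ : Θ → Ω → Θ)
    (hY : Measurable (Function.uncurry Y)) (hW' : Measurable (Function.uncurry W'))
    (hG : Measurable (Function.uncurry G)) (hGbar : Measurable (Function.uncurry Gbar))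
    (hDbar : Measurable (Function.uncurry Dbar)) (hV : Measurable (Function.uncurry V))
    (hBbar : Measurable (Function.uncurry Bbar)) (hΨ : Measurable (Function.uncurry Ψ))
    (hY2 : ∀ θ, MemLp (Y θ) 2 (P θ))
    -- (G1)
    (r : Θ → ℝ) (hr : Measurable r) (hr_pos : ∀ θ, 0 < r θ)
    (rbar : ℝ) (hrbar : 0 < rbar)
    (hVar : ∀ θ ∈ goodSet r rbar, 0 < Var[Y θ; P θ])
    -- (G2)
    (hStein : ∀ θ ∈ goodSet r rbar,
      IsSteinCoupling (P θ) (standardize P Y θ) (W' θ) (G θ))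
    -- (G3)
    (hGD_int : ∀ θ ∈ goodSet r rbar,
      Integrable (fun ω => G θ ω * couplingDiff P Y W' θ ω) (P θ))
    (hGD : ⨆ θ ∈ goodSet r rbar, ENNReal.ofReal (r θ) *
      posExp (P θ) (fun ω => |((P θ)[fun ω' => 1 - G θ ω' * couplingDiff P Y W' θ ω' |
        MeasurableSpace.comap (standardize P Y θ) inferInstance]) ω|) < ∞)
    (hWGD : ⨆ θ ∈ goodSet r rbar, ENNReal.ofReal (r θ) *
      posExp (P θ) (fun ω =>
        (1 + |standardize P Y θ ω|) * |G θ ω| * couplingDiff P Y W' θ ω ^ 2) < ∞)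
    -- (G4)
    (ℱ : Θ → MeasurableSpace Ω) (F₁ : Θ → Set Ω)
    (hℱ : ∀ θ ∈ goodSet r rbar, ℱ θ ≤ mΩ)
    (hF₁ : ∀ θ ∈ goodSet r rbar, MeasurableSet (F₁ θ))
    (hGbar_meas : ∀ θ ∈ goodSet r rbar, Measurable[ℱ θ] (Gbar θ))
    (hDbar_meas : ∀ θ ∈ goodSet r rbar, Measurable[ℱ θ] (Dbar θ))
    (hGbar_le : ∀ θ ∈ goodSet r rbar, ∀ᵐ ω ∂(P θ), ω ∈ F₁ θ → |G θ ω| ≤ Gbar θ ω)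
    (hDbar_le : ∀ θ ∈ goodSet r rbar, ∀ᵐ ω ∂(P θ), ω ∈ F₁ θ →
      |couplingDiff P Y W' θ ω| ≤ Dbar θ ω)
    (hF₁_mom : ⨆ θ ∈ goodSet r rbar, ENNReal.ofReal (r θ ^ 2) *
      posExp ((P θ).restrict (F₁ θ)ᶜ)
        (fun ω => |G θ ω| * couplingDiff P Y W' θ ω ^ 2) < ∞)
    (hbar_mom : ⨆ θ ∈ goodSet r rbar, ENNReal.ofReal (r θ) *
      posExp (P θ) (fun ω => Gbar θ ω * Dbar θ ω ^ 2) < ∞)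
    -- (G5)
    (F₂ : Θ → Set Ω)
    (hΨ_meas : ∀ θ ∈ goodSet r rbar, Measurable[ℱ θ] (Ψ θ))
    (hF₂ : ∀ θ ∈ goodSet r rbar, MeasurableSet[ℱ θ] (F₂ θ))
    (hV_law : ∀ θ ∈ goodSet r rbar, HasCondLawOn (P θ) (ℱ θ) (V θ) (F₂ θ)
      (fun ω => (P (Ψ θ ω)).map (Y (Ψ θ ω))))
    (hF₂_mom : ⨆ θ ∈ goodSet r rbar, ENNReal.ofReal (r θ ^ 2) *
      posExp ((P θ).restrict (F₂ θ)ᶜ)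
        (fun ω => |G θ ω| * couplingDiff P Y W' θ ω ^ 2) < ∞)
    -- (G6)
    (hBbar_meas : ∀ θ ∈ goodSet r rbar, Measurable[ℱ θ] (Bbar θ))
    (hBbar_le : ∀ θ ∈ goodSet r rbar, ∀ᵐ ω ∂(P θ), ω ∈ F₁ θ →
      (√Var[Y θ; P θ])⁻¹ * |Y θ ω - V θ ω| ≤ Bbar θ ω)
    (hBbar_mom : ⨆ θ ∈ goodSet r rbar, ENNReal.ofReal (r θ ^ 2) *
      posExp ((P θ).restrict (F₂ θ))
        (fun ω => Gbar θ ω * Dbar θ ω ^ 2 * Bbar θ ω) < ∞)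
    -- (G7)
    (hσ_ratio : ⨆ θ ∈ goodSet r rbar,
      essSupOn (P θ) (F₂ θ ∩ {ω | Ψ θ ω ∈ goodSet r rbar})
        (fun ω => Var[Y θ; P θ] / Var[Y (Ψ θ ω); P (Ψ θ ω)]) < ∞)
    (hr_ratio : ⨆ θ ∈ goodSet r rbar,
      essSupOn (P θ) (F₂ θ) (fun ω => r θ / r (Ψ θ ω)) < ∞)
    (hr_ratio' : ⨆ θ ∈ goodSet r rbar,
      essSupOn (P θ) (F₂ θ ∩ {ω | Ψ θ ω ∈ goodSet r rbar})
        (fun ω => r (Ψ θ ω) / r θ) < ∞) :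
    ∃ C : ℝ, ∀ θ : Θ,
      ⨆ z : ℝ, |(P θ).real {ω | standardize P Y θ ω ≤ z}
        - (gaussianReal 0 1).real (Set.Iic z)| ≤ C / r θ :=
  theorem1_general P Y W' G Gbar Dbar V Bbar Ψ r rbar (fun _ _ => hY.of_uncurry_left)
    (fun _ _ => hW'.of_uncurry_left) (fun _ _ => hG.of_uncurry_left)
    (fun _ _ => hV.of_uncurry_left) hY2 hr_pos hrbar hVar hStein hGD_int hGD hWGD ℱ F₁ hℱ hF₁
    hGbar_meas hDbar_meas hGbar_le hDbar_le hF₁_mom hbar_mom F₂ hF₂ hV_law hF₂_mom hBbar_meas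
    hBbar_le hBbar_mom hσ_ratio hr_ratio
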